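/- **Setting.** Let $n\ge 1$, $q\ge 1$, $X\subseteq[q]^n$ and $f:X\to\{0,1\}$. A *span program* $P=(H,V,\tau,A)$ on $[q]^n$ (over real or complex scalars $\mathbb K$) consists of a finite-dimensional inner product space that is an orthogonal direct sum $H=H_1\oplus\cdots\oplus H_n\oplus H_{\mathrm{true}}\oplus H_{\mathrm{false}}$, subspaces $H_{j,a}\subseteq H_j$ ($j\in[n]$, $a\in[q]$) with $\sum_a H_{j,a}=H_j$, a vector space $V$, a vector $\tau\in V$, and a linear map $A:H\to V$. For $x\in[q]^n$ put $H(x)=H_{1,x_1}\oplus\cdots\oplus H_{n,x_n}\oplus H_{\mathrm{true}}$. A *positive witness* for $x$ is a $w\in H(x)$ with $Aw=\tau$. A *negative witness* for $x$ is a linear functional $\omega:V\to\mathbb K$ with $\omega\tau=1$ and $\omega A\Pi_{H(x)}=0$, where $\Pi_{H(x)}$ is the orthogonal projection onto $H(x)$. Every $x$ has a witness of exactly one of the two kinds, and the witness size $w(P,x)$ is the minimum of $\|w\|^2$ over the positive witnesses $w$, respectively of $\|\omega A\|^2$ over the negative witnesses $\omega$. $P$ *decides* $f$ if each $x\in f^{-1}(1)$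 has a positive witness and each $x\in f^{-1}(0)$ has a negative witness; put $W=\max_{\chi\in X}w(P,\chi)$. A *quantum query algorithm* has the state space $\mathbb C^n\otimes\mathbb C^q\otimes\mathbb C^d$ for some finite $d$ and starts in a fixed computational basis state. At each step it may apply a unitary that does not depend on $x$, apply the oracle $O_x:|i\rangle|b\rangle\mapsto|i\rangle|x_i+b \bmod q\rangle$ (one query), make a computational basis measurement and continue according to the outcome, or stop and output a bit. The number of queries made in a run is thus a random variable. **Theorem 3.1.** There are universal constants $C>0$ and $k\in\mathbb N$ such that the following holds. Let $P$ be a span program on $[q]^n$ that decides $f:X\to\{0,1\}$ and is scaled so that $w(P,x)\ge1$ for all $x\in X$ (for instance, a scaled and normalized one, for which in addition the maximum positive and the maximum negative witness size agree). Then for every $0<\delta<1$ there is a quantum query algorithm, depending on $P$, $f$ and $\delta$ but not on $x$ (in particular it is not given $w(P,x)$), such that for every $x\in X$, with probability at least $1-C\delta$, it outputs $f(x)$ and makes at most $$C\,\sqrt{w(P,x)\,W}\;\log_2(1/\delta)\,\bigl(\log_2(2+W)\bigr)^k$$ queries to $O_x$. That is, it evaluates $f(x)$ with probability $1-O(\delta)$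 using $\tilde O\bigl(\sqrt{w(P,x)W}\,\log(1/\delta)\bigr)$ queries, where $\tilde O$ hides only factors polylogarithmic in $W$. -/

import Mathlib

/-- A span program on `[q]^n` (inputs `x : Fin n → Fin q`) over the scalars `𝕜` (`ℝ` or `ℂ`).
The finite-dimensional inner product space `H` is the orthogonal direct sum
`H_1 ⊕ ⋯ ⊕ H_n ⊕ H_true ⊕ H_false`, each `H_j` is the (not necessarily direct) sum of subspaces
`H_{j,a}`, `V` is a vector space with a target vector `τ`, and `A : H → V` is linear. -/
structure SpanProgram (𝕜 : Type*) [RCLike 𝕜] (n q : ℕ)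
    (H : Type*) [NormedAddCommGroup H] [InnerProductSpace 𝕜 H] [FiniteDimensional 𝕜 H]
    (V : Type*) [AddCommGroup V] [Module 𝕜 V] where
  /-- the summand `H_j` -/
  block : Fin n → Submodule 𝕜 H
  /-- the subspace `H_{j,a}` of `H_j` -/
  part : Fin n → Fin q → Submodule 𝕜 H
  /-- the summand `H_true` -/
  Htrue : Submodule 𝕜 H
  /-- the summand `H_false` -/
  Hfalse : Submodule 𝕜 H
  sum_part : ∀ j, ⨆ a, part j a = block j
  block_ortho_block : ∀ i j, i ≠ j → block i ⟂ block j
  block_ortho_true : ∀ j, block j ⟂ Htrue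
  block_ortho_false : ∀ j, block j ⟂ Hfalse
  true_ortho_false : Htrue ⟂ Hfalse
  sum_eq_top : (⨆ j, block j) ⊔ Htrue ⊔ Hfalse = ⊤
  /-- the target vector `τ` -/
  target : V
  /-- the linear operator `A` -/
  A : H →ₗ[𝕜] V

namespace SpanProgram

variable {𝕜 : Type*} [RCLike 𝕜] {n q : ℕ}
  {H : Type*} [NormedAddCommGroup H] [InnerProductSpace 𝕜 H] [FiniteDimensional 𝕜 H]
  {V : Type*} [AddCommGroup V] [Module 𝕜 V]

/-- The subspace `H(x) = H_{1,x_1} ⊕ ⋯ ⊕ H_{n,x_n} ⊕ H_true`. -/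
def space (P : SpanProgram 𝕜 n q H V) (x : Fin n → Fin q) : Submodule 𝕜 H :=
  (⨆ j, P.part j (x j)) ⊔ P.Htrue

/-- `w` is a positive witness for `x`: `w ∈ H(x)` and `A w = τ`. -/
def IsPositiveWitness (P : SpanProgram 𝕜 n q H V) (x : Fin n → Fin q) (w : H) : Prop :=
  w ∈ P.space x ∧ P.A w = P.target

/-- `ω` is a negative witness for `x`: `ω τ = 1` and `ω A Π_{H(x)} = 0`, where `Π_{H(x)}` is the
orthogonal projection of `H` onto `H(x)`. -/
def IsNegativeWitness (P : SpanProgram 𝕜 n q H V) (x : Fin n → Fin q) (ω : V →ₗ[𝕜] 𝕜) : Prop :=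
  ω P.target = 1 ∧ ∀ h : H, ω (P.A ((P.space x).starProjection h)) = 0

/-- The minimum of `‖w‖²` over the positive witnesses `w` for `x`. -/
noncomputable def positiveSize (P : SpanProgram 𝕜 n q H V) (x : Fin n → Fin q) : ℝ :=
  sInf {s : ℝ | ∃ w : H, P.IsPositiveWitness x w ∧ s = ‖w‖ ^ 2}

/-- The minimum of `‖ω A‖²` (operator norm) over the negative witnesses `ω` for `x`. -/
noncomputable def negativeSize (P : SpanProgram 𝕜 n q H V) (x : Fin n → Fin q) : ℝ :=
  sInf {s : ℝ | ∃ ω : V →ₗ[𝕜] 𝕜, P.IsNegativeWitness x ω ∧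
    s = ‖LinearMap.toContinuousLinearMap (ω ∘ₗ P.A)‖ ^ 2}

open Classical in
/-- The witness size `w(P,x)`. Every `x` has either a positive or a negative witness, never both. -/
noncomputable def witnessSize (P : SpanProgram 𝕜 n q H V) (x : Fin n → Fin q) : ℝ :=
  if ∃ w, P.IsPositiveWitness x w then P.positiveSize x else P.negativeSize x

/-- `P` decides `f : X → {0,1}`, where `X ⊆ [q]^n`. -/
def Decides (P : SpanProgram 𝕜 n q H V) {X : Set (Fin n → Fin q)} (f : X → Bool) : Prop :=
  (∀ x : X, f x = true → ∃ w, P.IsPositiveWitness x w) ∧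
    ∀ x : X, f x = false → ∃ ω, P.IsNegativeWitness x ω

/-- `W = max_{χ ∈ X} w(P,χ)` (a maximum, since `X` is finite). -/
noncomputable def maxWitnessSize (P : SpanProgram 𝕜 n q H V) (X : Set (Fin n → Fin q)) : ℝ :=
  ⨆ χ : X, P.witnessSize χ

end SpanProgram

/-- Labels `(i, b, z)` of the computational basis `|i⟩|b⟩|z⟩` of `ℂ^n ⊗ ℂ^q ⊗ ℂ^d`: query index
register, query answer register, workspace. -/
abbrev QueryBasis (n q d : ℕ) : Type := Fin n × Fin q × Fin d

/-- The state space `ℂ^n ⊗ ℂ^q ⊗ ℂ^d`. -/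
abbrev QueryState (n q d : ℕ) : Type := EuclideanSpace ℂ (QueryBasis n q d)

/-- The permutation `(i, b, z) ↦ (i, x_i + b mod q, z)` of the basis labels. -/
def oraclePerm {n q : ℕ} [NeZero q] (d : ℕ) (x : Fin n → Fin q) :
    Equiv.Perm (QueryBasis n q d) where
  toFun s := (s.1, x s.1 + s.2.1, s.2.2)
  invFun s := (s.1, -x s.1 + s.2.1, s.2.2)
  left_inv s := by simp
  right_inv s := by simp

/-- The oracle `O_x |i⟩|b⟩|z⟩ = |i⟩|x_i + b mod q⟩|z⟩`, a unitary. -/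
noncomputable def oracle {n q : ℕ} [NeZero q] (d : ℕ) (x : Fin n → Fin q) :
    QueryState n q d ≃ₗᵢ[ℂ] QueryState n q d :=
  LinearIsometryEquiv.piLpCongrLeft 2 ℂ ℂ (oraclePerm d x)

/-- The (unnormalized) state after the outcome `c` of the computational basis measurement that
reveals the bit `g s` of the basis label `s`. -/
noncomputable def measured {n q d : ℕ} (g : QueryBasis n q d → Bool) (c : Bool)
    (ψ : QueryState n q d) : QueryState n q d :=
  WithLp.toLp 2 fun s => if g s = c then ψ s else 0

/-- Adaptive quantum query protocols: at each step, stop and output a bit, apply a unitary that does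
not depend on the input, apply the oracle once, or make a two-outcome measurement in the
computational basis and continue depending on the outcome. -/
inductive QueryProtocol (n q d : ℕ) : Type
  | output (b : Bool) : QueryProtocol n q d
  | gate (U : QueryState n q d ≃ₗᵢ[ℂ] QueryState n q d) (next : QueryProtocol n q d) :
      QueryProtocol n q d
  | query (next : QueryProtocol n q d) : QueryProtocol n q d
  | measure (g : QueryBasis n q d → Bool) (next : Bool → QueryProtocol n q d) :
      QueryProtocol n q d

open Classical in
/-- The contribution to the probability of the event `E` (a condition on the output and on the total
number of queries) when the protocol is run with oracle `O_x` from the unnormalized state `ψ`, after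
`t` queries have already been made: branches of the measurement tree are weighted by the squared norm
of their final unnormalized state. -/
noncomputable def QueryProtocol.weight {n q d : ℕ} [NeZero q] (x : Fin n → Fin q)
    (E : Bool → ℕ → Prop) : QueryProtocol n q d → QueryState n q d → ℕ → ℝ
  | .output b, ψ, t => if E b t then ‖ψ‖ ^ 2 else 0
  | .gate U next, ψ, t => next.weight x E (U ψ) t
  | .query next, ψ, t => next.weight x E (oracle d x ψ) (t + 1)
  | .measure g next, ψ, t => ∑ c : Bool, (next c).weight x E (measured g c ψ) t

/-- A quantum query algorithm: a workspace dimension, a basis state to start from, and a protocol.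
None of them depends on the input `x`. -/
structure QueryAlgorithm (n q : ℕ) where
  /-- dimension of the workspace -/
  dim : ℕ
  /-- label of the initial basis state -/
  start : QueryBasis n q dim
  /-- the steps of the algorithm -/
  protocol : QueryProtocol n q dim

/-- The probability, when the algorithm is run on `x`, of the event `E` (a condition on the output
and on the number of queries to `O_x` that were made). -/
noncomputable def QueryAlgorithm.prob {n q : ℕ} [NeZero q] (𝒜 : QueryAlgorithm n q)
    (x : Fin n → Fin q) (E : Bool → ℕ → Prop) : ℝ :=
  𝒜.protocol.weight x E (EuclideanSpace.single 𝒜.start 1) 0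

/-! The span program becomes a walk U, the product of two reflections: one about a subspace R
independent of x, one about the preimage under the oracle of another subspace G independent of x.
Let e be a unit vector orthogonal to the embedded copy of H. Take for R the embedded kernel of c ⊕ h
↦ cτ − αAh, and for G the span of the |i⟩|a⟩|h⟩ with h ∈ H_{i,a}, together with the images of e
under the oracles. A positive witness w gives a vector u = e + w/α that U fixes and whose inner
product with e is 1. A negative witness ω, through the Riesz vector g of ωA, gives v = e − αg
orthogonal to R with O(v − e) orthogonal to G, whence Uv − v = 2Ue. So the average N⁻¹ ∑_{t<N} Uᵗe
has norm at least 1/‖u‖ in the first case and, by telescoping (`norm_sum_pow_apply_le`), at most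
‖v‖/N in the second. A clock register turns the squared norm of this average into an acceptance
probability (`exists_isTrial_walk`), without any spectral analysis of U.

With α² = 64σ this tests for a positive witness of size at most σ, and it is reliable against
negative witnesses of size s once N² ≥ 64(1 + 64σs). Passing to orthogonal complements and inverting
α exchanges the two kinds (`exists_isTrial`).

As w(P,x) is not known, σ is doubled from level to level, with s = 2W throughout. The test for the
wrong kind rejects at every level. The test for the right kind accepts as soon as σ exceeds w(P,x),
and an earlier acceptance is also correct (`le_weight_scan`). At that level N is O(√(w(P,x)W)). A
majority of O(log(1/δ) + log(2+W)) runs of each test makes the total error O(δ). -/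

open scoped InnerProductSpace

/-! ### Weights of protocols and complete measurements. -/

namespace QueryProtocol

lemma measured_smul {n q d : ℕ} (g : QueryBasis n q d → Bool) (b : Bool) (c : ℂ) (ψ : QueryState n q d) :
    measured g b (c • ψ) = c • measured g b ψ := by
  ext s
  simp [measured]

variable {n q d : ℕ} [NeZero q] {x : Fin n → Fin q} {E : Bool → ℕ → Prop}

lemma weight_nonneg (p : QueryProtocol n q d) :
    ∀ (ψ : QueryState n q d) (t : ℕ), 0 ≤ p.weight x E ψ t := by
  induction p with
  | output b =>
    intro ψ t
    simp only [weight]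
    split_ifs <;> positivity
  | gate U next ih => exact fun ψ t => ih _ _
  | query next ih => exact fun ψ t => ih _ _
  | measure g next ih =>
    intro ψ t
    simp only [weight]
    exact Finset.sum_nonneg fun c _ => ih c _ _

lemma weight_smul (p : QueryProtocol n q d) (c : ℂ) :
    ∀ (ψ : QueryState n q d) (t : ℕ),
      p.weight x E (c • ψ) t = ‖c‖ ^ 2 * p.weight x E ψ t := by
  induction p with
  | output b =>
    intro ψ t
    simp only [weight, norm_smul, mul_pow]
    split_ifs <;> simp
  | gate U next ih => exact fun ψ t => by simp only [weight, map_smul, ih]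
  | query next ih => exact fun ψ t => by simp only [weight, map_smul, ih]
  | measure g next ih =>
    intro ψ t
    simp only [weight, measured_smul, ih, Finset.mul_sum]

/-- Measure in turn whether the label is `s`, for the labels `s` of the list, until one is hit, and
continue according to that label. -/
def measureList (next : QueryBasis n q d → QueryProtocol n q d) :
    List (QueryBasis n q d) → QueryProtocol n q d
  -- When the list contains all labels the remaining state is zero, so this output does not matter.
  | [] => .output false
  | s :: l => .measure (fun s' => decide (s' = s))
      fun b => if b then next s else measureList next l

/-- A hit on `s` leaves the multiple `ψ s` of a basis state, and weights are homogeneous of degree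
two; a miss does not change the later amplitudes. An inequality suffices, since only lower bounds on
success are needed. -/
lemma le_weight_measureList (next : QueryBasis n q d → QueryProtocol n q d) (t : ℕ)
    (l : List (QueryBasis n q d)) (hl : l.Nodup) (ψ : QueryState n q d) :
    (l.map fun s => ‖ψ s‖ ^ 2 * (next s).weight x E (EuclideanSpace.single s 1) t).sum ≤
      (measureList next l).weight x E ψ t := by
  induction l generalizing ψ with
  | nil => exact weight_nonneg _ _ _
  | cons s l ih =>
    obtain ⟨hs, hl⟩ := List.nodup_cons.1 hl
    have h_hit : measured (fun s' => decide (s' = s)) true ψ =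
        ψ s • EuclideanSpace.single s (1 : ℂ) := by
      ext s'
      by_cases h : s' = s
      · subst h; simp [measured]
      · simp [measured, h]
    have h_miss : ∀ s' ∈ l, measured (fun s' => decide (s' = s)) false ψ s' = ψ s' := by
      intro s' hs'
      have : s' ≠ s := fun h => hs (h ▸ hs')
      simp [measured, this]
    simp only [measureList, weight, Fintype.sum_bool, List.map_cons, List.sum_cons, if_true,
      Bool.false_eq_true, if_false]
    rw [h_hit, weight_smul]
    refine add_le_add le_rfl (le_trans (le_of_eq ?_) (ih hl _))
    congr 1
    refine List.map_congr_left fun s' hs' => ?_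
    rw [h_miss s' hs']

/-- Measure all labels, reset the state to the label `s₀` and continue according to the outcome. -/
noncomputable def measureReset (s₀ : QueryBasis n q d)
    (next : QueryBasis n q d → QueryProtocol n q d) : QueryProtocol n q d :=
  measureList (fun s => .gate (LinearIsometryEquiv.piLpCongrLeft 2 ℂ ℂ (Equiv.swap s s₀)) (next s))
    Finset.univ.toList

lemma le_weight_measureReset (s₀ : QueryBasis n q d)
    (next : QueryBasis n q d → QueryProtocol n q d) (t : ℕ) (ψ : QueryState n q d) :
    ∑ s, ‖ψ s‖ ^ 2 * (next s).weight x E (EuclideanSpace.single s₀ 1) t ≤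
      (measureReset s₀ next).weight x E ψ t := by
  refine le_trans (le_of_eq ?_) (le_weight_measureList _ t _ (Finset.nodup_toList _) ψ)
  rw [Finset.sum_map_toList]
  refine Finset.sum_congr rfl fun s _ => ?_
  simp only [weight]
  congr 2
  erw [LinearIsometryEquiv.piLpCongrLeft_single]
  simp

/-! ### Coin flips, majority votes and the scan over levels. -/

/-- On input `x`, the protocol transformer `T` acts from the basis state `s₀` as a coin flip that
costs `c` queries and gives `true` with probability `p`, the state being reset to `s₀`. -/
def IsTrial (s₀ : QueryBasis n q d) (x : Fin n → Fin q)
    (T : (Bool → QueryProtocol n q d) → QueryProtocol n q d) (c : ℕ) (p : ℝ) : Prop :=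
  (0 ≤ p ∧ p ≤ 1) ∧ ∀ (E : Bool → ℕ → Prop) (next : Bool → QueryProtocol n q d) (t : ℕ),
    p * (next true).weight x E (EuclideanSpace.single s₀ 1) (t + c) +
      (1 - p) * (next false).weight x E (EuclideanSpace.single s₀ 1) (t + c) ≤
    (T next).weight x E (EuclideanSpace.single s₀ 1) t

/-- Repeat `T` a number of times, starting with the balance `s`, and continue according to the
majority of the outcomes. -/
def vote (T : (Bool → QueryProtocol n q d) → QueryProtocol n q d) :
    ℕ → ℤ → (Bool → QueryProtocol n q d) → QueryProtocol n q d
  | 0, s, next => next (decide (0 < s))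
  | m + 1, s, next => T fun b => vote T m (if b then s + 1 else s - 1) next

/-- The probability that a majority vote over `m` flips of a coin of bias `p`, starting with the
balance `s`, gives `true`. -/
noncomputable def voteProb (p : ℝ) : ℕ → ℤ → ℝ
  | 0, s => if 0 < s then 1 else 0
  | m + 1, s => p * voteProb p m (s + 1) + (1 - p) * voteProb p m (s - 1)

lemma voteProb_mem {p : ℝ} (h0 : 0 ≤ p) (h1 : p ≤ 1) (m : ℕ) :
    ∀ s, 0 ≤ voteProb p m s ∧ voteProb p m s ≤ 1 := by
  induction m with
  | zero => intro s; simp only [voteProb]; split_ifs <;> norm_num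
  | succ m ih =>
    intro s
    have ha := ih (s + 1)
    have hb := ih (s - 1)
    simp only [voteProb]
    constructor
    · have := mul_nonneg h0 ha.1
      have := mul_nonneg (sub_nonneg.2 h1) hb.1
      linarith
    · have := mul_le_mul_of_nonneg_left ha.2 h0
      have := mul_le_mul_of_nonneg_left hb.2 (sub_nonneg.2 h1)
      linarith

lemma isTrial_vote {s₀ : QueryBasis n q d}
    {T : (Bool → QueryProtocol n q d) → QueryProtocol n q d} {c : ℕ} {p : ℝ}
    (hT : IsTrial s₀ x T c p) (m : ℕ) :
    ∀ s, IsTrial s₀ x (vote T m s) (m * c) (voteProb p m s) := by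
  induction m with
  | zero =>
    refine fun s => ⟨voteProb_mem hT.1.1 hT.1.2 _ _, fun E next t => ?_⟩
    by_cases h : 0 < s <;> simp [vote, voteProb, h]
  | succ m ih =>
    refine fun s => ⟨voteProb_mem hT.1.1 hT.1.2 _ _, fun E next t => ?_⟩
    have ha := (ih (s + 1)).2 E next (t + c)
    have hb := (ih (s - 1)).2 E next (t + c)
    have h := hT.2 E (fun b => vote T m (if b then s + 1 else s - 1) next) t
    simp only [if_true, Bool.false_eq_true, if_false] at h
    have ha' := mul_le_mul_of_nonneg_left ha hT.1.1
    have hb' := mul_le_mul_of_nonneg_left hb (sub_nonneg.2 hT.1.2)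
    have e : t + (m + 1) * c = t + c + m * c := by ring
    simp only [vote, voteProb, e]
    linarith

/-- An exponential moment bound: the expectation of 8 to the power minus the balance shrinks by a
factor 1/4 at each flip, and it dominates the probability that the final balance is not positive. -/
lemma one_sub_le_voteProb {p : ℝ} (hp : 63 / 64 ≤ p) (h1 : p ≤ 1) (m : ℕ) :
    ∀ s : ℤ, 1 - (8 : ℝ) ^ (-s) * (1 / 4) ^ m ≤ voteProb p m s := by
  induction m with
  | zero =>
    intro s
    simp only [voteProb, pow_zero, mul_one]
    split_ifs with h
    · have : (0 : ℝ) < 8 ^ (-s) := by positivity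
      linarith
    · have : (1 : ℝ) ≤ 8 ^ (-s) := one_le_zpow₀ (by norm_num) (by omega)
      linarith
  | succ m ih =>
    intro s
    have ha := mul_le_mul_of_nonneg_left (ih (s + 1)) (by linarith : 0 ≤ p)
    have hb := mul_le_mul_of_nonneg_left (ih (s - 1)) (sub_nonneg.2 h1)
    have ea : (8 : ℝ) ^ (-(s + 1)) = 8 ^ (-s) * (1 / 8) := by
      rw [neg_add, zpow_add₀ (by norm_num)]; norm_num
    have eb : (8 : ℝ) ^ (-(s - 1)) = 8 ^ (-s) * 8 := by
      rw [neg_sub, sub_eq_neg_add, zpow_add₀ (by norm_num)]; norm_num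
    rw [ea] at ha
    rw [eb] at hb
    have hA : (0 : ℝ) < 8 ^ (-s) * (1 / 4) ^ m := by positivity
    -- The worst case p = 63/64 gives 63/512 + 64/512 = 127/512 < 1/4; this margin is the reason for
    -- the threshold 63/64.
    have hc := mul_nonneg hA.le (by linarith : 0 ≤ 1 / 4 - (p * (1 / 8) + (1 - p) * 8))
    simp only [voteProb, pow_succ]
    nlinarith

lemma voteProb_le {p : ℝ} (h0 : 0 ≤ p) (hp : p ≤ 1 / 64) (m : ℕ) :
    ∀ s : ℤ, voteProb p m s ≤ (8 : ℝ) ^ s * (1 / 4) ^ m := by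
  induction m with
  | zero =>
    intro s
    simp only [voteProb, pow_zero, mul_one]
    split_ifs with h
    · exact one_le_zpow₀ (by norm_num) (by omega)
    · positivity
  | succ m ih =>
    intro s
    have ha := mul_le_mul_of_nonneg_left (ih (s + 1)) h0
    have hb := mul_le_mul_of_nonneg_left (ih (s - 1)) (by linarith : 0 ≤ 1 - p)
    rw [zpow_add₀ (by norm_num), zpow_one] at ha
    rw [zpow_sub₀ (by norm_num), zpow_one] at hb
    have hA : (0 : ℝ) < 8 ^ s * (1 / 4) ^ m := by positivity
    have hc := mul_nonneg hA.le (by linarith : 0 ≤ 1 / 4 - (p * 8 + (1 - p) * (1 / 8)))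
    simp only [voteProb, pow_succ]
    nlinarith

/-- At each level take the majority of `m` runs of the test for `true` and of the test for `false`,
and stop as soon as one of them succeeds. -/
def scan (T : ℕ → Bool → (Bool → QueryProtocol n q d) → QueryProtocol n q d) (m : ℕ) :
    ℕ → ℕ → QueryProtocol n q d
  | 0, _ => .output false
  | r + 1, i => vote (T i true) m 0 fun b => if b then .output true else
      vote (T i false) m 0 fun b => if b then .output false else scan T m r (i + 1)

lemma weight_output_eq_one {s₀ : QueryBasis n q d} {v : Bool} {t : ℕ} {Q : ℝ} (h : (t : ℝ) ≤ Q) :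
    (QueryProtocol.output v : QueryProtocol n q d).weight x (fun b t => b = v ∧ (t : ℝ) ≤ Q)
      (EuclideanSpace.single s₀ 1) t = 1 := by
  simp [weight, h]

section scan

variable {s₀ : QueryBasis n q d}
    {T : ℕ → Bool → (Bool → QueryProtocol n q d) → QueryProtocol n q d} {m : ℕ} {c : ℕ → ℕ}
    {p : ℕ → Bool → ℝ} {v : Bool} {Q : ℝ}

lemma le_weight_scan_succ (hT : ∀ i b, IsTrial s₀ x (T i b) (c i) (p i b)) (r i t : ℕ) :
    voteProb (p i true) m 0 * (QueryProtocol.output true : QueryProtocol n q d).weight x E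
        (EuclideanSpace.single s₀ 1) (t + m * c i) +
      (1 - voteProb (p i true) m 0) *
        (voteProb (p i false) m 0 * (QueryProtocol.output false : QueryProtocol n q d).weight x E
            (EuclideanSpace.single s₀ 1) (t + m * c i + m * c i) +
          (1 - voteProb (p i false) m 0) * (scan T m r (i + 1)).weight x E
            (EuclideanSpace.single s₀ 1) (t + m * c i + m * c i)) ≤
      (scan T m (r + 1) i).weight x E (EuclideanSpace.single s₀ 1) t := by
  have h1 := isTrial_vote (hT i true) m 0
  have h2 := isTrial_vote (hT i false) m 0
  refine le_trans ?_ (h1.2 E _ t)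
  simp only [if_true, Bool.false_eq_true, if_false]
  gcongr
  · exact sub_nonneg.2 h1.1.2
  · refine le_trans (le_of_eq ?_) (h2.2 E _ _)
    simp only [if_true, Bool.false_eq_true, if_false]

/-- Two votes have to be right at most: for `v = false` the vote for `true`, taken first, must fail
and then the other succeed; for `v = true` the first vote settles it. -/
lemma le_weight_scan_of_success (hT : ∀ i b, IsTrial s₀ x (T i b) (c i) (p i b)) (r i t : ℕ)
    (hw : p i (!v) ≤ 1 / 64) (hr : 63 / 64 ≤ p i v) (hQ : ((t + 2 * m * c i : ℕ) : ℝ) ≤ Q) :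
    1 - 2 * (1 / 4 : ℝ) ^ m ≤ (scan T m (r + 1) i).weight x (fun b t => b = v ∧ (t : ℝ) ≤ Q)
      (EuclideanSpace.single s₀ 1) t := by
  have hQ2 : ((t + m * c i + m * c i : ℕ) : ℝ) ≤ Q := by
    refine le_trans (le_of_eq ?_) hQ
    push_cast; ring
  have hQ1 : ((t + m * c i : ℕ) : ℝ) ≤ Q := by
    refine le_trans ?_ hQ2
    norm_cast; omega
  have hs := one_sub_le_voteProb hr (hT i v).1.2 m 0
  have hf := voteProb_le (hT i (!v)).1.1 hw m 0
  simp only [neg_zero, zpow_zero, one_mul] at hs hf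
  have h := le_weight_scan_succ (m := m) (E := fun b t => b = v ∧ (t : ℝ) ≤ Q) hT r i t
  refine le_trans ?_ h
  have hη : (0 : ℝ) < (1 / 4) ^ m := by positivity
  have hρ := weight_nonneg (x := x) (E := fun b t => b = v ∧ (t : ℝ) ≤ Q) (scan T m r (i + 1))
    (EuclideanSpace.single s₀ 1) (t + m * c i + m * c i)
  have ha := voteProb_mem (hT i true).1.1 (hT i true).1.2 m 0
  have hb := voteProb_mem (hT i false).1.1 (hT i false).1.2 m 0
  cases v
  · rw [weight_output_eq_one hQ2]
    simp only [Bool.not_false] at hf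
    have h0 := weight_nonneg (x := x) (E := fun b t => b = false ∧ (t : ℝ) ≤ Q)
      (.output true) (EuclideanSpace.single s₀ 1 : QueryState n q d) (t + m * c i)
    have h3 := mul_nonneg ha.1 h0
    have h4 := mul_nonneg (sub_nonneg.2 hb.2) hρ
    have h5 := mul_nonneg (sub_nonneg.2 ha.2) h4
    nlinarith
  · rw [weight_output_eq_one hQ1]
    have h0 := weight_nonneg (x := x) (E := fun b t => b = true ∧ (t : ℝ) ≤ Q)
      (.output false) (EuclideanSpace.single s₀ 1 : QueryState n q d) (t + m * c i + m * c i)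
    have h3 := mul_nonneg hb.1 h0
    have h4 := mul_nonneg (sub_nonneg.2 hb.2) hρ
    have h5 := mul_nonneg (sub_nonneg.2 ha.2) (add_nonneg h3 h4)
    linarith

/-- Nothing is assumed about the test for the right value: its success ends the run correctly, with
weight 1 ≥ `B`, and its failure leads to the next level. Only an error of the wrong test costs
anything. -/
lemma le_weight_scan_of_next (hT : ∀ i b, IsTrial s₀ x (T i b) (c i) (p i b)) (r i t : ℕ)
    (hw : p i (!v) ≤ 1 / 64) (hQ : ((t + 2 * m * c i : ℕ) : ℝ) ≤ Q) {B : ℝ} (hB : B ≤ 1)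
    (hρ : B ≤ (scan T m r (i + 1)).weight x (fun b t => b = v ∧ (t : ℝ) ≤ Q)
      (EuclideanSpace.single s₀ 1) (t + 2 * m * c i)) :
    B - 2 * (1 / 4 : ℝ) ^ m ≤ (scan T m (r + 1) i).weight x (fun b t => b = v ∧ (t : ℝ) ≤ Q)
      (EuclideanSpace.single s₀ 1) t := by
  have e : t + 2 * m * c i = t + m * c i + m * c i := by ring
  rw [e] at hρ hQ
  have hQ1 : ((t + m * c i : ℕ) : ℝ) ≤ Q := by
    refine le_trans ?_ hQ
    norm_cast; omega
  have hf := voteProb_le (hT i (!v)).1.1 hw m 0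
  simp only [zpow_zero, one_mul] at hf
  have h := le_weight_scan_succ (m := m) (E := fun b t => b = v ∧ (t : ℝ) ≤ Q) hT r i t
  refine le_trans ?_ h
  have hη : (0 : ℝ) < (1 / 4) ^ m := by positivity
  have ha := voteProb_mem (hT i true).1.1 (hT i true).1.2 m 0
  have hb := voteProb_mem (hT i false).1.1 (hT i false).1.2 m 0
  cases v
  · rw [weight_output_eq_one hQ]
    simp only [Bool.not_false] at hf
    have h0 := weight_nonneg (x := x) (E := fun b t => b = false ∧ (t : ℝ) ≤ Q)
      (.output true) (EuclideanSpace.single s₀ 1 : QueryState n q d) (t + m * c i)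
    have h3 := mul_nonneg ha.1 h0
    have h4 := mul_le_mul_of_nonneg_left hρ (sub_nonneg.2 hb.2)
    have h5 : B ≤ voteProb (p i false) m 0 * 1 + (1 - voteProb (p i false) m 0) * B := by
      nlinarith
    have h6 := mul_le_mul_of_nonneg_left (h5.trans (add_le_add_right h4 _)) (sub_nonneg.2 ha.2)
    nlinarith
  · rw [weight_output_eq_one hQ1]
    simp only [Bool.not_true] at hf
    have h0 := weight_nonneg (x := x) (E := fun b t => b = true ∧ (t : ℝ) ≤ Q)
      (.output false) (EuclideanSpace.single s₀ 1 : QueryState n q d) (t + m * c i + m * c i)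
    have h3 := mul_nonneg hb.1 h0
    have h4 := mul_le_mul_of_nonneg_left hρ (sub_nonneg.2 hb.2)
    have h5 : B - (1 / 4) ^ m ≤ (1 - voteProb (p i false) m 0) * B := by nlinarith
    have h6 := mul_le_mul_of_nonneg_left (h5.trans (h4.trans (le_add_of_nonneg_left h3)))
      (sub_nonneg.2 ha.2)
    nlinarith

/-- If at every level the test for the wrong value fails with high probability, and at level
`i + r` the test for the right value succeeds with high probability, then `scan` started at level
`i` gives the right value with high probability and stops at level `i + r` at the latest. -/
lemma le_weight_scan (hT : ∀ i b, IsTrial s₀ x (T i b) (c i) (p i b)) (r : ℕ) :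
    ∀ (r' i t : ℕ), (∀ j, j ≤ i + r → p j (!v) ≤ 1 / 64) → 63 / 64 ≤ p (i + r) v → r < r' →
      ((t + ∑ j ∈ Finset.range (r + 1), 2 * m * c (i + j) : ℕ) : ℝ) ≤ Q →
      1 - (2 * r + 2) * (1 / 4 : ℝ) ^ m ≤
        (scan T m r' i).weight x (fun b t => b = v ∧ (t : ℝ) ≤ Q) (EuclideanSpace.single s₀ 1) t := by
  induction r with
  | zero =>
    intro r' i t hw hr hr' hQ
    obtain ⟨r', rfl⟩ := Nat.exists_eq_succ_of_ne_zero (by omega : r' ≠ 0)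
    have := le_weight_scan_of_success (Q := Q) (m := m) hT r' i t (hw i (by omega)) hr
      (by simpa using hQ)
    simpa using this
  | succ r ih =>
    intro r' i t hw hr hr' hQ
    obtain ⟨r', rfl⟩ := Nat.exists_eq_succ_of_ne_zero (by omega : r' ≠ 0)
    rw [Finset.sum_range_succ'] at hQ
    have e : i + (r + 1) = i + 1 + r := by ring
    have hη : (0 : ℝ) < (1 / 4) ^ m := by positivity
    have := ih r' (i + 1) (t + 2 * m * c i) (fun j hj => hw j (by omega)) (e ▸ hr) (by omega) (by
      refine le_trans (le_of_eq ?_) hQ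
      simp only [add_zero, add_assoc, add_comm, add_left_comm])
    have := le_weight_scan_of_next (Q := Q) hT r' i t (hw i (by omega)) (by
      refine le_trans ?_ hQ
      norm_cast
      simp only [add_zero]
      omega) (by nlinarith [(Nat.cast_nonneg r : (0 : ℝ) ≤ r)]) this
    refine le_trans (le_of_eq ?_) this
    push_cast
    ring

end scan

end QueryProtocol

/-! ### Products of two reflections. -/

section Walk

variable {E : Type*} [NormedAddCommGroup E] [InnerProductSpace ℂ E]

/-- If `U v - v = 2 U e`, the sums of the orbit of `e` under `U` telescope. -/
lemma norm_sum_pow_apply_le (U : E ≃ₗᵢ[ℂ] E) {e v : E} (h : U v - v = (2 : ℂ) • U e) (N : ℕ) :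
    ‖∑ t ∈ Finset.range N, (U ^ t) e‖ ≤ ‖v‖ := by
  have key : ∀ N : ℕ, (2 : ℂ) • U (∑ t ∈ Finset.range N, (U ^ t) e) = (U ^ N) v - v := by
    intro N
    induction N with
    | zero => simp
    | succ N ih =>
      rw [Finset.sum_range_succ, map_add, smul_add, ih]
      have : U ((U ^ N) e) = (U ^ N) (U e) := by
        change (U * U ^ N) e = (U ^ N * U) e
        rw [← pow_succ', pow_succ]
      rw [this, ← map_smul, ← h, map_sub, pow_succ, LinearIsometryEquiv.coe_mul]
      simp
  have h2 := congrArg norm (key N)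
  rw [norm_smul, LinearIsometryEquiv.norm_map] at h2
  have h3 := norm_sub_le ((U ^ N) v) v
  rw [LinearIsometryEquiv.norm_map] at h3
  norm_num at h2
  linarith

lemma pow_apply_of_apply_eq_self (U : E ≃ₗᵢ[ℂ] E) {u : E} (h : U u = u) (t : ℕ) :
    (U ^ t) u = u := by
  induction t with
  | zero => simp
  | succ t ih => rw [pow_succ, LinearIsometryEquiv.coe_mul, Function.comp_apply, h, ih]

lemma inner_sum_pow_apply (U : E ≃ₗᵢ[ℂ] E) {e u : E} (h : U u = u) (N : ℕ) :
    ⟪u, ∑ t ∈ Finset.range N, (U ^ t) e⟫_ℂ = N * ⟪u, e⟫_ℂ := by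
  rw [inner_sum, Finset.sum_congr rfl fun t _ => ?_, Finset.sum_const, Finset.card_range,
    nsmul_eq_mul]
  conv_lhs => rw [← pow_apply_of_apply_eq_self U h t]
  exact LinearIsometryEquiv.inner_map_map _ _ _

/-- The product of the reflections about `O⁻¹ G` and about `R`. -/
noncomputable def walkOp (O : E ≃ₗᵢ[ℂ] E) (G R : E ≃ₗᵢ[ℂ] E) : E ≃ₗᵢ[ℂ] E :=
  R * (O⁻¹ * (G * O))

lemma walkOp_apply (O : E ≃ₗᵢ[ℂ] E) (G R : E ≃ₗᵢ[ℂ] E) (ψ : E) :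
    walkOp O G R ψ = R (O.symm (G (O ψ))) := rfl

lemma walkOp_eq_self (O : E ≃ₗᵢ[ℂ] E) (G R : Submodule ℂ E) [G.HasOrthogonalProjection]
    [R.HasOrthogonalProjection] {u : E} (hR : u ∈ R) (hG : O u ∈ G) :
    walkOp O G.reflection R.reflection u = u := by
  rw [walkOp_apply, Submodule.reflection_mem_subspace_eq_self hG,
    LinearIsometryEquiv.symm_apply_apply, Submodule.reflection_mem_subspace_eq_self hR]

/-- The first reflection fixes e and negates v − e, so it sends v to 2e − v; the second one negates
v. Hence Uv = 2Re + v, where Re = Ue is the reflected e. -/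
lemma walkOp_sub_self (O : E ≃ₗᵢ[ℂ] E) (G R : Submodule ℂ E) [G.HasOrthogonalProjection]
    [R.HasOrthogonalProjection] {e v : E} (hR : v ∈ Rᗮ) (hG : O e ∈ G) (hGv : O (v - e) ∈ Gᗮ) :
    walkOp O G.reflection R.reflection v - v =
      (2 : ℂ) • walkOp O G.reflection R.reflection e := by
  have h1 : walkOp O G.reflection R.reflection e = R.reflection e := by
    rw [walkOp_apply, Submodule.reflection_mem_subspace_eq_self hG,
      LinearIsometryEquiv.symm_apply_apply]
  have h2 : walkOp O G.reflection R.reflection (v - e) = - R.reflection (v - e) := by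
    rw [walkOp_apply, Submodule.reflection_mem_subspace_orthogonalComplement_eq_neg hGv, map_neg,
      LinearIsometryEquiv.symm_apply_apply, map_neg]
  have h3 : R.reflection v = -v :=
    Submodule.reflection_mem_subspace_orthogonalComplement_eq_neg hR
  have h4 : walkOp O G.reflection R.reflection v = (2 : ℂ) • R.reflection e + v := by
    have : v = e + (v - e) := by abel
    rw [this, map_add, h1, h2, map_sub, h3, two_smul]
    abel
  rw [h4, h1]
  abel

end Walk

/-! ### Unitaries with prescribed action on the computational basis. -/

section Euclidean

variable {ι : Type*} [Fintype ι]

/-- A measurement in a subspace is a computational basis measurement after a unitary. -/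
lemma exists_measurement (M : Submodule ℂ (EuclideanSpace ℂ ι)) :
    ∃ (V : EuclideanSpace ℂ ι ≃ₗᵢ[ℂ] EuclideanSpace ℂ ι) (g : ι → Bool), ∀ ψ,
      ∑ s, (if g s then ‖V ψ s‖ ^ 2 else 0) = ‖M.starProjection ψ‖ ^ 2 := by
  classical
  set b := stdOrthonormalBasis ℂ M
  have hcard : Fintype.card (Fin (Module.finrank ℂ M)) ≤ Fintype.card ι := by
    rw [Fintype.card_fin, ← finrank_euclideanSpace (𝕜 := ℂ)]
    exact Submodule.finrank_le M
  obtain ⟨j⟩ := Function.Embedding.nonempty_of_card_le hcard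
  -- The value 0 off the range of `j` is never used: only the restriction to that range is completed
  -- to an orthonormal basis.
  set v : ι → EuclideanSpace ℂ ι := Function.extend j (fun a => (b a : EuclideanSpace ℂ ι)) 0
  have hv : ∀ a, v (j a) = b a := fun a => j.injective.extend_apply _ _ a
  have horth : Orthonormal ℂ ((Set.range j).domRestrict v) := by
    rw [orthonormal_iff_ite]
    rintro ⟨_, a, rfl⟩ ⟨_, a', rfl⟩
    have := orthonormal_iff_ite.1 b.orthonormal a a'
    simpa [hv, j.injective.eq_iff, Subtype.ext_iff] using this
  obtain ⟨B, hB⟩ := Orthonormal.exists_orthonormalBasis_extension_of_card_eq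
    (finrank_euclideanSpace (𝕜 := ℂ)) horth
  refine ⟨B.repr, fun s => decide (s ∈ Set.range j), fun ψ => ?_⟩
  have hsum : ∑ s, (if decide (s ∈ Set.range j) = true then ‖B.repr ψ s‖ ^ 2 else 0) =
      ∑ a, ‖B.repr ψ (j a)‖ ^ 2 := by
    simp only [decide_eq_true_eq]
    rw [← Finset.sum_filter, ← Finset.sum_map Finset.univ j (fun s => ‖B.repr ψ s‖ ^ 2)]
    refine Finset.sum_congr ?_ fun _ _ => rfl
    ext s; simp
  rw [hsum, Submodule.starProjection_apply, ← Submodule.coe_norm, ← b.repr.norm_map,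
    EuclideanSpace.norm_sq_eq]
  refine Finset.sum_congr rfl fun a _ => ?_
  rw [B.repr_apply_apply, b.repr_apply_apply, hB _ ⟨a, rfl⟩, hv]
  rw [Submodule.inner_orthogonalProjectionOnto_eq_of_mem_left]

lemma exists_isometry_apply_eq {a b : EuclideanSpace ℂ ι} (ha : ‖a‖ = 1) (hb : ‖b‖ = 1) :
    ∃ V : EuclideanSpace ℂ ι ≃ₗᵢ[ℂ] EuclideanSpace ℂ ι, V a = b := by
  classical
  obtain ⟨i⟩ : Nonempty ι := by
    by_contra h
    rw [not_nonempty_iff] at h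
    rw [Subsingleton.elim a 0, norm_zero] at ha
    exact zero_ne_one ha
  have key : ∀ c : EuclideanSpace ℂ ι, ‖c‖ = 1 →
      ∃ B : OrthonormalBasis ι ℂ (EuclideanSpace ℂ ι), B i = c := by
    intro c hc
    have : Orthonormal ℂ (({i} : Set ι).domRestrict fun _ => c) :=
      ⟨fun _ => hc, fun s t hst => absurd (Subsingleton.elim s t) hst⟩
    obtain ⟨B, hB⟩ := Orthonormal.exists_orthonormalBasis_extension_of_card_eq
      (finrank_euclideanSpace (𝕜 := ℂ)) this
    exact ⟨B, hB i rfl⟩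
  obtain ⟨A, rfl⟩ := key a ha
  obtain ⟨B, rfl⟩ := key b hb
  exact ⟨A.repr.trans B.repr.symm, by simp⟩

end Euclidean

/-! ### The clock register and the walk controlled by it. -/

section Layers

variable {n q d : ℕ} (M : ℕ)

/-- Labels with a workspace `Fin (d * M)` as pairs of a layer and a label with workspace `Fin d`. -/
def layerEquiv : QueryBasis n q (d * M) ≃ Σ _ : Fin M, QueryBasis n q d where
  toFun s := ⟨(finProdFinEquiv.symm s.2.2).2, s.1, s.2.1, (finProdFinEquiv.symm s.2.2).1⟩
  invFun s := (s.2.1, s.2.2.1, finProdFinEquiv (s.2.2.2, s.1))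
  left_inv s := by
    obtain ⟨i, b, z⟩ := s
    simp only [Prod.mk.eta, Equiv.apply_symm_apply]
  right_inv s := by simp

/-- A state with workspace `Fin (d * M)` as a family of `M` states with workspace `Fin d`. -/
noncomputable def layers :
    QueryState n q (d * M) ≃ₗᵢ[ℂ] PiLp 2 fun _ : Fin M => QueryState n q d :=
  (LinearIsometryEquiv.piLpCongrLeft 2 ℂ ℂ (layerEquiv M)).trans
    (LinearIsometryEquiv.piLpCurry ℂ 2 fun _ _ => ℂ)

lemma oracle_apply [NeZero q] (x : Fin n → Fin q) (ψ : QueryState n q d) (s : QueryBasis n q d) :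
    oracle d x ψ s = ψ (s.1, -x s.1 + s.2.1, s.2.2) := rfl

lemma layers_oracle [NeZero q] (x : Fin n → Fin q) (ψ : QueryState n q (d * M)) (t : Fin M) :
    layers M (oracle (d * M) x ψ) t = oracle d x (layers M ψ t) := rfl

lemma layers_oracle_symm [NeZero q] (x : Fin n → Fin q) (ψ : QueryState n q (d * M)) (t : Fin M) :
    layers M ((oracle (d * M) x).symm ψ) t = (oracle d x).symm (layers M ψ t) := by
  rw [LinearIsometryEquiv.eq_symm_apply, ← layers_oracle, LinearIsometryEquiv.apply_symm_apply]

variable (n q d) in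
/-- The gate `|i⟩|b⟩|z⟩ ↦ |i⟩|-b⟩|z⟩`. -/
noncomputable def negGate [NeZero q] : QueryState n q d ≃ₗᵢ[ℂ] QueryState n q d :=
  LinearIsometryEquiv.piLpCongrLeft 2 ℂ ℂ
    ((Equiv.refl _).prodCongr ((Equiv.neg _).prodCongr (Equiv.refl _)))

lemma negGate_apply [NeZero q] (ψ : QueryState n q d) (s : QueryBasis n q d) :
    negGate n q d ψ s = ψ (s.1, -s.2.1, s.2.2) := rfl

/-- Conjugating by b ↦ −b turns the addition of x_i into its subtraction. This provides the inverse
oracle, which is not a step of a protocol, so that one walk step costs two queries. -/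
lemma negGate_oracle_negGate [NeZero q] (x : Fin n → Fin q) (ψ : QueryState n q d) :
    negGate n q d (oracle d x (negGate n q d ψ)) = (oracle d x).symm ψ := by
  rw [LinearIsometryEquiv.eq_symm_apply]
  ext s
  simp [oracle_apply, negGate_apply]

/-- Apply `f t` in layer `t`. -/
noncomputable def layerwise (f : Fin M → QueryState n q d ≃ₗᵢ[ℂ] QueryState n q d) :
    QueryState n q (d * M) ≃ₗᵢ[ℂ] QueryState n q (d * M) :=
  (layers M).trans ((LinearIsometryEquiv.piLpCongrRight 2 f).trans (layers M).symm)

lemma layers_layerwise (f : Fin M → QueryState n q d ≃ₗᵢ[ℂ] QueryState n q d)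
    (ψ : QueryState n q (d * M)) (t : Fin M) :
    layers M (layerwise M f ψ) t = f t (layers M ψ t) := by
  simp [layerwise]

variable {M}

lemma layers_ext {ψ φ : QueryState n q (d * M)} (h : ∀ t, layers M ψ t = layers M φ t) :
    ψ = φ := (layers M).injective (PiLp.ext h)

namespace QueryProtocol

variable [NeZero q]

/-- Apply `min t N` walk steps in layer `t`. -/
noncomputable def walk (G R : QueryState n q d ≃ₗᵢ[ℂ] QueryState n q d) :
    ℕ → QueryProtocol n q (d * M) → QueryProtocol n q (d * M)
  | 0, next => next
  | N + 1, next => .query (.gate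
      ((layerwise M fun t => if N < t then G else LinearIsometryEquiv.refl ℂ _).trans
        (negGate n q (d * M)))
      (.query (.gate
        ((negGate n q (d * M)).trans
          (layerwise M fun t => if N < t then R else LinearIsometryEquiv.refl ℂ _))
        (walk G R N next))))

/-- A round with counter `N + 1` reflects only in the layers beyond `N`; in the others the query and
its inverse cancel. So only gates are controlled by the layer, never the oracle. -/
lemma weight_walk (G R : QueryState n q d ≃ₗᵢ[ℂ] QueryState n q d) (x : Fin n → Fin q)
    (E : Bool → ℕ → Prop) (next : QueryProtocol n q (d * M)) (N : ℕ) :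
    ∀ (ψ : QueryState n q (d * M)) (t : ℕ), (walk G R N next).weight x E ψ t =
      next.weight x E (layerwise M (fun l => walkOp (oracle d x) G R ^ min (l : ℕ) N) ψ)
        (t + 2 * N) := by
  induction N with
  | zero =>
    intro ψ t
    simp only [walk, Nat.min_zero, pow_zero]
    congr 1
    refine layers_ext fun l => ?_
    rw [layers_layerwise]
    rfl
  | succ N ih =>
    intro ψ t
    simp only [walk, weight, ih, LinearIsometryEquiv.trans_apply]
    rw [negGate_oracle_negGate, show t + 1 + 1 + 2 * N = t + 2 * (N + 1) by ring]
    congr 1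
    refine layers_ext fun l => ?_
    simp only [layers_layerwise, layers_oracle_symm, layers_oracle]
    by_cases h : N < l
    · rw [if_pos h, if_pos h, min_eq_right h.le, min_eq_right (Nat.succ_le_of_lt h), pow_succ,
        LinearIsometryEquiv.coe_mul, Function.comp_apply, walkOp_apply]
    · rw [if_neg h, if_neg h, min_eq_left (by omega), min_eq_left (by omega)]
      simp

/-- Prepare the state `prep |s₀⟩`, walk for `N` steps, apply `final`, measure, reset and continue
according to the bit `g` of the outcome. -/
noncomputable def walkTest (s₀ : QueryBasis n q (d * M))
    (prep : QueryState n q (d * M) ≃ₗᵢ[ℂ] QueryState n q (d * M))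
    (G R : QueryState n q d ≃ₗᵢ[ℂ] QueryState n q d) (N : ℕ)
    (final : QueryState n q (d * M) ≃ₗᵢ[ℂ] QueryState n q (d * M))
    (g : QueryBasis n q (d * M) → Bool) (next : Bool → QueryProtocol n q (d * M)) :
    QueryProtocol n q (d * M) :=
  .gate prep (walk G R N (.gate final (measureReset s₀ fun s => next (g s))))

lemma isTrial_walkTest (s₀ : QueryBasis n q (d * M))
    (prep : QueryState n q (d * M) ≃ₗᵢ[ℂ] QueryState n q (d * M))
    (G R : QueryState n q d ≃ₗᵢ[ℂ] QueryState n q d) (N : ℕ)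
    (final : QueryState n q (d * M) ≃ₗᵢ[ℂ] QueryState n q (d * M))
    (g : QueryBasis n q (d * M) → Bool) (x : Fin n → Fin q) :
    IsTrial s₀ x (walkTest s₀ prep G R N final g) (2 * N)
      (∑ s, if g s then ‖final (layerwise M
        (fun l => walkOp (oracle d x) G R ^ min (l : ℕ) N)
          (prep (EuclideanSpace.single s₀ 1))) s‖ ^ 2 else 0) := by
  set Ψ := final (layerwise M (fun l => walkOp (oracle d x) G R ^ min (l : ℕ) N)
    (prep (EuclideanSpace.single s₀ 1))) with hΨ
  have hnorm : ∑ s, ‖Ψ s‖ ^ 2 = 1 := by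
    rw [← EuclideanSpace.norm_sq_eq, hΨ]
    simp
  have hsplit : ∑ s, (if g s then ‖Ψ s‖ ^ 2 else 0) + ∑ s, (if g s then 0 else ‖Ψ s‖ ^ 2) = 1 := by
    rw [← Finset.sum_add_distrib, ← hnorm]
    refine Finset.sum_congr rfl fun s _ => ?_
    split_ifs <;> simp
  have h0 : 0 ≤ ∑ s, (if g s then ‖Ψ s‖ ^ 2 else 0) :=
    Finset.sum_nonneg fun s _ => by split_ifs <;> positivity
  have h1 : 0 ≤ ∑ s, (if g s then 0 else ‖Ψ s‖ ^ 2) :=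
    Finset.sum_nonneg fun s _ => by split_ifs <;> positivity
  refine ⟨⟨h0, by linarith⟩, fun E next t => ?_⟩
  rw [← eq_sub_iff_add_eq'.2 hsplit]
  simp only [walkTest, weight, weight_walk]
  refine le_trans (le_of_eq ?_) (le_weight_measureReset _ _ _ _)
  rw [Finset.sum_mul, Finset.sum_mul, ← Finset.sum_add_distrib]
  refine Finset.sum_congr rfl fun s _ => ?_
  rw [← hΨ]
  cases g s <;> simp

end QueryProtocol

/-! ### Uniform superpositions over the clock and the phase detection test. -/

lemma sum_fin_ite_lt {A : Type*} [AddCommMonoid A] {N : ℕ} (hN : N ≤ M) (f : ℕ → A) :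
    ∑ t : Fin M, (if (t : ℕ) < N then f t else 0) = ∑ t ∈ Finset.range N, f t := by
  rw [← Finset.sum_range (fun t => if t < N then f t else 0), ← Finset.sum_filter]
  refine Finset.sum_congr ?_ fun _ _ => rfl
  ext t
  simp only [Finset.mem_filter, Finset.mem_range]
  omega

/-- The vector with the same component `y` in each of the first `N` layers. -/
noncomputable def spread (n q d M N : ℕ) : QueryState n q d →ₗ[ℂ] QueryState n q (d * M) :=
  (layers M).symm.toLinearEquiv.toLinearMap ∘ₗ (WithLp.linearEquiv 2 ℂ _).symm.toLinearMap ∘ₗ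
    LinearMap.pi fun t : Fin M => if (t : ℕ) < N then LinearMap.id else 0

lemma layers_spread (N : ℕ) (y : QueryState n q d) (t : Fin M) :
    layers M (spread n q d M N y) t = if (t : ℕ) < N then y else 0 := by
  simp only [spread, LinearMap.comp_apply]
  change layers M ((layers M).symm _) t = _
  rw [LinearIsometryEquiv.apply_symm_apply]
  by_cases h : (t : ℕ) < N <;> simp [h]

lemma inner_spread {N : ℕ} (y : QueryState n q d) (ψ : QueryState n q (d * M)) :
    ⟪spread n q d M N y, ψ⟫_ℂ = ∑ t : Fin M, if (t : ℕ) < N then ⟪y, layers M ψ t⟫_ℂ else 0 := by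
  rw [← (layers M).inner_map_map, PiLp.inner_apply]
  refine Finset.sum_congr rfl fun t _ => ?_
  rw [layers_spread]
  split_ifs <;> simp

lemma norm_spread_sq {N : ℕ} (hN : N ≤ M) (y : QueryState n q d) :
    ‖spread n q d M N y‖ ^ 2 = N * ‖y‖ ^ 2 := by
  have h := inner_spread (N := N) y (spread n q d M N y)
  have h2 : ∀ t : Fin M, (if (t : ℕ) < N then ⟪y, layers M (spread n q d M N y) t⟫_ℂ else 0) =
      if (t : ℕ) < N then ⟪y, y⟫_ℂ else 0 := fun t => by
    rw [layers_spread]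
    split_ifs <;> rfl
  rw [Finset.sum_congr rfl fun t _ => h2 t, sum_fin_ite_lt hN fun _ => ⟪y, y⟫_ℂ, Finset.sum_const,
    Finset.card_range, inner_self_eq_norm_sq_to_K, inner_self_eq_norm_sq_to_K, nsmul_eq_mul] at h
  refine Complex.ofReal_injective ?_
  push_cast
  exact h

variable [NeZero q]

open QueryProtocol in
/-- The phase detection test for the walk `R.reflection ∘ O⁻¹ ∘ G.reflection ∘ O`: it succeeds with
the probability `‖N⁻¹ ∑ t < N, U ^ t e‖²`. -/
theorem exists_isTrial_walk {N : ℕ} (hN : 0 < N) (hNM : N ≤ M) (s₀ : QueryBasis n q (d * M))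
    (G R : Submodule ℂ (QueryState n q d)) {e : QueryState n q d} (he : ‖e‖ = 1) :
    ∃ T : (Bool → QueryProtocol n q (d * M)) → QueryProtocol n q (d * M),
      ∀ x : Fin n → Fin q, ∃ p, IsTrial s₀ x T (2 * N) p ∧
        (∀ u ∈ R, oracle d x u ∈ G → ⟪u, e⟫_ℂ = 1 → ‖u‖ ^ 2 ≤ 65 / 64 → 63 / 64 ≤ p) ∧
        (∀ v ∈ Rᗮ, oracle d x e ∈ G → oracle d x (v - e) ∈ Gᗮ → 64 * ‖v‖ ^ 2 ≤ (N : ℝ) ^ 2 →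
          p ≤ 1 / 64) := by
  have hNR : (0 : ℝ) < N := by exact_mod_cast hN
  have hs : (0 : ℝ) < √N := Real.sqrt_pos.2 hNR
  have hss : √(N : ℝ) ^ 2 = N := Real.sq_sqrt hNR.le
  obtain ⟨prep, hprep⟩ : ∃ prep : QueryState n q (d * M) ≃ₗᵢ[ℂ] QueryState n q (d * M),
      prep (EuclideanSpace.single s₀ 1) = ((√N : ℝ) : ℂ)⁻¹ • spread n q d M N e := by
    refine exists_isometry_apply_eq (by simp) ?_
    rw [← sq_eq_sq₀ (norm_nonneg _) zero_le_one, norm_smul, mul_pow, norm_spread_sq hNM, he,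
      norm_inv, Complex.norm_real, Real.norm_of_nonneg hs.le, inv_pow, hss]
    field_simp
  -- The test accepts on the states that are uniform over the first `N` layers; projecting there
  -- averages the Uᵗe.
  obtain ⟨final, g, hfinal⟩ := exists_measurement (LinearMap.range (spread n q d M N))
  refine ⟨walkTest s₀ prep G.reflection R.reflection N final g, fun x =>
    ⟨_, isTrial_walkTest s₀ prep G.reflection R.reflection N final g x, ?_⟩⟩
  rw [hfinal, hprep]
  set U := walkOp (oracle d x) G.reflection R.reflection with hU
  set Ψ := layerwise M (fun l => U ^ min (l : ℕ) N) (((√N : ℝ) : ℂ)⁻¹ • spread n q d M N e) with hΨ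
  set K := LinearMap.range (spread n q d M N)
  have hinner : ∀ y, ⟪spread n q d M N y, Ψ⟫_ℂ =
      ((√N : ℝ) : ℂ)⁻¹ * ⟪y, ∑ t ∈ Finset.range N, (U ^ t) e⟫_ℂ := by
    intro y
    rw [inner_spread, inner_sum, Finset.mul_sum,
      ← sum_fin_ite_lt hNM fun t => ((√N : ℝ) : ℂ)⁻¹ * ⟪y, (U ^ t) e⟫_ℂ]
    refine Finset.sum_congr rfl fun t _ => ?_
    split_ifs with h
    · rw [hΨ, layers_layerwise, map_smul, PiLp.smul_apply, layers_spread, if_pos h, map_smul,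
        inner_smul_right, min_eq_left h.le]
    · rfl
  have hproj : ∀ y, ⟪spread n q d M N y, K.starProjection Ψ⟫_ℂ = ⟪spread n q d M N y, Ψ⟫_ℂ :=
    fun y => by
      rw [← Submodule.inner_starProjection_left_eq_right,
        Submodule.starProjection_eq_self_iff.2 (LinearMap.mem_range_self _ y)]
  constructor
  · intro u huR huG hue hu
    have hUu : U u = u := walkOp_eq_self _ _ _ huR huG
    have h1 := hinner u
    rw [inner_sum_pow_apply U hUu, hue, mul_one, ← hproj] at h1
    have h2 := norm_inner_le_norm (𝕜 := ℂ) (spread n q d M N u) (K.starProjection Ψ)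
    rw [h1, norm_mul, norm_inv, Complex.norm_real, Real.norm_of_nonneg hs.le, Complex.norm_natCast]
      at h2
    have h3 := pow_le_pow_left₀ (by positivity) h2 2
    rw [mul_pow, mul_pow, norm_spread_sq hNM, inv_pow, hss] at h3
    have h4 : (N : ℝ)⁻¹ * (N : ℝ) ^ 2 = N := by field_simp
    rw [h4] at h3
    have h5 : 1 ≤ ‖u‖ ^ 2 * ‖K.starProjection Ψ‖ ^ 2 := by
      rw [mul_assoc] at h3
      exact le_of_mul_le_mul_left (by linarith) hNR
    -- The probability is at least 1/‖u‖² ≥ 64/65 > 63/64.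
    nlinarith [sq_nonneg ‖K.starProjection Ψ‖]
  · intro v hvR heG hvG hv
    -- With y the common component of the projection, p = N‖y‖² = ⟪spread y, Ψ⟫ ≤ ‖y‖‖v‖/√N.
    -- Squaring and cancelling one factor p yields p ≤ ‖v‖²/N².
    obtain ⟨y, hy⟩ : K.starProjection Ψ ∈ K := Submodule.starProjection_apply_mem _ _
    have hsum := norm_sum_pow_apply_le U (walkOp_sub_self _ _ _ hvR heG hvG) N
    have h1 := hproj y
    rw [hinner, hy, inner_self_eq_norm_sq_to_K] at h1
    have h2 := congrArg norm h1
    rw [norm_mul, norm_inv, Complex.norm_real, Real.norm_of_nonneg hs.le, norm_pow,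
      RCLike.norm_ofReal, abs_norm] at h2
    have h3 : ‖K.starProjection Ψ‖ ^ 2 ≤ (√N)⁻¹ * (‖y‖ * ‖v‖) := by
      refine le_trans (le_of_eq h2) ?_
      gcongr
      exact (norm_inner_le_norm (𝕜 := ℂ) y (∑ t ∈ Finset.range N, (U ^ t) e)).trans (by gcongr)
    have h4 : ‖K.starProjection Ψ‖ ^ 2 = N * ‖y‖ ^ 2 := by rw [← hy, norm_spread_sq hNM]
    set P := ‖K.starProjection Ψ‖ ^ 2
    have hP : 0 ≤ P := sq_nonneg _
    have h5 := pow_le_pow_left₀ hP h3 2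
    rw [mul_pow, mul_pow, inv_pow, hss] at h5
    have h6 : (N : ℝ) * (N * P ^ 2) ≤ P * ‖v‖ ^ 2 := by
      rw [h4]
      rw [h4] at h5
      calc (N : ℝ) * (N * (N * ‖y‖ ^ 2) ^ 2) ≤ N * (N * ((N : ℝ)⁻¹ * (‖y‖ ^ 2 * ‖v‖ ^ 2))) := by
            gcongr
        _ = _ := by field_simp
    rcases hP.eq_or_lt with h0 | h0
    · rw [← h0]; norm_num
    · have h7 : (N : ℝ) ^ 2 * P ≤ ‖v‖ ^ 2 := by
        refine le_of_mul_le_mul_left (le_trans (le_of_eq ?_) h6) h0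
        ring
      have h8 : 0 < (N : ℝ) ^ 2 := by positivity
      refine le_of_mul_le_mul_left (a := (N : ℝ) ^ 2) ?_ h8
      linarith

end Layers

/-! ### Passage from real or complex scalars to ℂ. -/

section Complexify

variable {𝕜 : Type*} [RCLike 𝕜]

lemma RCLike.map_mul_complex (a b : 𝕜) :
    RCLike.map 𝕜 ℂ (a * b) = RCLike.map 𝕜 ℂ a * RCLike.map 𝕜 ℂ b := by
  rcases RCLike.I_eq_zero_or_im_I_eq_one (K := 𝕜) with h | h
  · have := RCLike.im_eq_zero h
    simp [RCLike.map_apply, this]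
  · apply Complex.ext <;> simp [RCLike.map_apply]

lemma RCLike.map_conj_complex (a : 𝕜) :
    RCLike.map 𝕜 ℂ (starRingEnd 𝕜 a) = starRingEnd ℂ (RCLike.map 𝕜 ℂ a) := by
  apply Complex.ext <;> simp [RCLike.map_apply]

lemma RCLike.map_ofReal_complex (a : ℝ) : RCLike.map 𝕜 ℂ (a : 𝕜) = a := by
  simp [RCLike.map_apply]

end Complexify

lemma Submodule.mem_span_orthogonal {E : Type*} [NormedAddCommGroup E] [InnerProductSpace ℂ E]
    {S : Set E} {v : E} (h : ∀ u ∈ S, ⟪v, u⟫_ℂ = 0) : v ∈ (Submodule.span ℂ S)ᗮ := by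
  rw [Submodule.mem_orthogonal']
  intro u hu
  induction hu using Submodule.span_induction with
  | mem u hu => exact h u hu
  | zero => exact inner_zero_right _
  | add a b _ _ ha hb => rw [inner_add_right, ha, hb, add_zero]
  | smul c a _ ha => rw [inner_smul_right, ha, mul_zero]

set_option linter.unusedSectionVars false

namespace SpanProgram

variable {𝕜 : Type*} [RCLike 𝕜] {n q : ℕ}
  {H : Type*} [NormedAddCommGroup H] [InnerProductSpace 𝕜 H] [FiniteDimensional 𝕜 H]
  {V : Type*} [AddCommGroup V] [Module 𝕜 V] (P : SpanProgram 𝕜 n q H V)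

/-! ### Decomposition of H along the query positions. -/

section Blocks

variable [NeZero n]

/-- The summands of `H`, with `H_true` and `H_false` joined to the first one. -/
def fullBlock (i : Fin n) : Submodule 𝕜 H :=
  if i = 0 then P.block i ⊔ P.Htrue ⊔ P.Hfalse else P.block i

/-- The subspaces `H_{i,a}`, with `H_true` joined to those with `i = 0`. -/
def fullPart (i : Fin n) (a : Fin q) : Submodule 𝕜 H :=
  if i = 0 then P.part i a ⊔ P.Htrue else P.part i a

lemma block_le_fullBlock (i : Fin n) : P.block i ≤ P.fullBlock i := by
  unfold fullBlock
  split_ifs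
  · exact le_sup_left.trans le_sup_left
  · exact le_rfl

lemma fullPart_le_fullBlock (i : Fin n) (a : Fin q) : P.fullPart i a ≤ P.fullBlock i := by
  have h : P.part i a ≤ P.block i := P.sum_part i ▸ le_iSup (P.part i) a
  unfold fullPart fullBlock
  split_ifs
  · exact (sup_le_sup_right h _).trans le_sup_left
  · exact h

lemma fullBlock_ortho (i j : Fin n) (h : i ≠ j) : P.fullBlock i ⟂ P.fullBlock j := by
  unfold fullBlock
  by_cases hi : i = 0
  · have hj : j ≠ 0 := fun hj => h (hi.trans hj.symm)
    simp only [if_pos hi, if_neg hj, Submodule.isOrtho_sup_left]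
    exact ⟨⟨P.block_ortho_block i j h, (P.block_ortho_true j).symm⟩,
      (P.block_ortho_false j).symm⟩
  · by_cases hj : j = 0
    · simp only [if_pos hj, if_neg hi, Submodule.isOrtho_sup_right]
      exact ⟨⟨P.block_ortho_block i j h, P.block_ortho_true i⟩, P.block_ortho_false i⟩
    · simp only [if_neg hi, if_neg hj]
      exact P.block_ortho_block i j h

lemma iSup_fullBlock : ⨆ i, P.fullBlock i = ⊤ := by
  have h0 : P.block 0 ⊔ P.Htrue ⊔ P.Hfalse ≤ ⨆ i, P.fullBlock i := by
    refine le_trans (le_of_eq ?_) (le_iSup P.fullBlock 0)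
    simp [fullBlock]
  rw [eq_top_iff, ← P.sum_eq_top]
  refine sup_le (sup_le ?_ (le_trans ?_ h0)) (le_sup_right.trans h0)
  · exact iSup_mono P.block_le_fullBlock
  · exact le_sup_right.trans le_sup_left

lemma fullPart_le_space (x : Fin n → Fin q) (i : Fin n) : P.fullPart i (x i) ≤ P.space x := by
  have h : P.part i (x i) ≤ P.space x :=
    (le_iSup (fun j => P.part j (x j)) i).trans le_sup_left
  unfold fullPart
  split_ifs
  · exact sup_le h le_sup_right
  · exact h

lemma space_le_iSup_fullPart (x : Fin n → Fin q) : P.space x ≤ ⨆ i, P.fullPart i (x i) := by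
  refine sup_le (iSup_mono fun i => ?_) (le_trans ?_ (le_iSup (fun i => P.fullPart i (x i)) 0))
  · unfold fullPart
    split_ifs
    · exact le_sup_left
    · exact le_rfl
  · simp [fullPart]

lemma sum_starProjection_fullBlock (h : H) : ∑ i, (P.fullBlock i).starProjection h = h :=
  OrthogonalFamily.sum_projection_of_mem_iSup
    (OrthogonalFamily.of_pairwise fun i j hij => P.fullBlock_ortho i j hij) h
    (P.iSup_fullBlock ▸ Submodule.mem_top)

/-- An element of H(x) is a sum of vectors of the enlarged parts, and by orthogonality the
projection onto block i retains only the i-th of them. -/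
lemma starProjection_fullBlock_mem {x : Fin n → Fin q} {h : H} (hh : h ∈ P.space x) (i : Fin n) :
    (P.fullBlock i).starProjection h ∈ P.fullPart i (x i) := by
  refine Submodule.iSup_induction (fun i => P.fullPart i (x i))
    (motive := fun h => (P.fullBlock i).starProjection h ∈ P.fullPart i (x i))
    (P.space_le_iSup_fullPart x hh) (fun j h hj => ?_) ?_ fun a b ha hb => ?_
  · by_cases hij : i = j
    · subst hij
      rwa [Submodule.starProjection_eq_self_iff.2 (P.fullPart_le_fullBlock _ _ hj)]
    · have : (P.fullBlock i).starProjection h = 0 := by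
        rw [Submodule.starProjection_apply, Submodule.coe_eq_zero,
          Submodule.orthogonalProjectionOnto_eq_zero_iff]
        exact (P.fullBlock_ortho i j hij).ge (P.fullPart_le_fullBlock _ _ hj)
      rw [this]
      exact Submodule.zero_mem _
  · rw [map_zero]
    exact Submodule.zero_mem _
  · rw [map_add]
    exact Submodule.add_mem _ ha hb

lemma sum_inner_starProjection (g h : H) :
    ∑ i, ⟪(P.fullBlock i).starProjection g, (P.fullBlock i).starProjection h⟫_𝕜 = ⟪g, h⟫_𝕜 := by
  conv_rhs => rw [← P.sum_starProjection_fullBlock h, inner_sum]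
  refine Finset.sum_congr rfl fun i _ => ?_
  rw [Submodule.inner_starProjection_left_eq_right,
    Submodule.starProjection_eq_self_iff.2 (Submodule.starProjection_apply_mem _ _)]

end Blocks

/-! ### Embedding of H into the state space, and witnesses as vectors there. -/

section Embedding

open Module (finrank)

/-- Complex coordinates of a vector, preceded by a `0`. -/
noncomputable def coord (h : H) : Fin (finrank 𝕜 H + 1) → ℂ :=
  Fin.cons 0 fun k => RCLike.map 𝕜 ℂ ((stdOrthonormalBasis 𝕜 H).repr h k)

lemma sum_inner_coord (g h : H) :
    ∑ z, ⟪coord (𝕜 := 𝕜) g z, coord (𝕜 := 𝕜) h z⟫_ℂ = RCLike.map 𝕜 ℂ ⟪g, h⟫_𝕜 := by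
  rw [Fin.sum_univ_succ, ← (stdOrthonormalBasis 𝕜 H).repr.inner_map_map, PiLp.inner_apply, map_sum]
  simp only [coord, Fin.cons_zero, Fin.cons_succ, inner_zero_left, zero_add]
  refine Finset.sum_congr rfl fun k _ => ?_
  simp only [RCLike.inner_apply, RCLike.map_mul_complex, RCLike.map_conj_complex]

variable (𝕜) in
/-- The state `|i⟩|a⟩|h⟩`. -/
noncomputable def ket (i : Fin n) (a : Fin q) (h : H) : QueryState n q (finrank 𝕜 H + 1) :=
  WithLp.toLp 2 fun s => if s.1 = i ∧ s.2.1 = a then coord (𝕜 := 𝕜) h s.2.2 else 0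

lemma inner_ket (i j : Fin n) (a b : Fin q) (g h : H) :
    ⟪ket 𝕜 i a g, ket 𝕜 j b h⟫_ℂ =
      if i = j ∧ a = b then RCLike.map 𝕜 ℂ ⟪g, h⟫_𝕜 else 0 := by
  rw [PiLp.inner_apply]
  simp only [ket]
  split_ifs with hij
  · obtain ⟨rfl, rfl⟩ := hij
    simp only [Fintype.sum_prod_type]
    rw [Finset.sum_eq_single i, Finset.sum_eq_single a]
    · simp only [and_self, if_true, sum_inner_coord]
    · intro a' _ ha'
      simp [ha']
    · simp
    · intro i' _ hi'
      simp [hi']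
    · simp
  · refine Finset.sum_eq_zero fun s _ => ?_
    by_cases h1 : s.1 = i ∧ s.2.1 = a
    · have : ¬ (s.1 = j ∧ s.2.1 = b) := fun h2 =>
        hij ⟨h1.1.symm.trans h2.1, h1.2.symm.trans h2.2⟩
      rw [if_neg this, inner_zero_right]
    · rw [if_neg h1, inner_zero_left]

variable [NeZero n] [NeZero q]

lemma oracle_ket (x : Fin n → Fin q) (i : Fin n) (a : Fin q) (h : H) :
    oracle _ x (ket 𝕜 i a h) = ket 𝕜 i (x i + a) h := by
  ext s
  rw [oracle_apply]
  simp only [ket]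
  refine if_congr (and_congr_right fun hs => ?_) rfl rfl
  rw [hs, neg_add_eq_iff_eq_add]

variable (𝕜 n q H) in
/-- A basis state in the kernel of all the coordinates of `H`. -/
noncomputable def extra (a : Fin q) : QueryState n q (finrank 𝕜 H + 1) :=
  EuclideanSpace.single (0, a, 0) 1

lemma oracle_extra (x : Fin n → Fin q) (a : Fin q) :
    oracle _ x (extra 𝕜 n q H a) = extra 𝕜 n q H (x 0 + a) := by
  rw [oracle, extra]
  erw [LinearIsometryEquiv.piLpCongrLeft_single]
  rfl

/-- The leading 0 of `coord` reserves workspace label 0 for the extra states. -/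
lemma inner_extra_ket (a b : Fin q) (i : Fin n) (h : H) :
    ⟪extra 𝕜 n q H a, ket 𝕜 i b h⟫_ℂ = 0 := by
  rw [extra, EuclideanSpace.inner_single_left]
  simp [ket, coord]

lemma norm_extra (a : Fin q) : ‖extra 𝕜 n q H a‖ = 1 := by
  simp [extra]

/-- The state `∑ i, |i⟩|x_i⟩|h_i⟩` for `h = ∑ i, h_i`. -/
noncomputable def place (x : Fin n → Fin q) (h : H) : QueryState n q (finrank 𝕜 H + 1) :=
  ∑ i, ket 𝕜 i (x i) ((P.fullBlock i).starProjection h)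

/-- The link between the two reflections: the kernel condition is imposed with blank answers,
independently of x, and one query writes the x_i that membership in H(x) refers to. -/
lemma oracle_place (x : Fin n → Fin q) (h : H) :
    oracle _ x (P.place 0 h) = P.place x h := by
  simp [place, oracle_ket]

lemma inner_place (x : Fin n → Fin q) (g h : H) :
    ⟪P.place x g, P.place x h⟫_ℂ = RCLike.map 𝕜 ℂ ⟪g, h⟫_𝕜 := by
  rw [place, place, sum_inner, ← P.sum_inner_starProjection, map_sum]
  refine Finset.sum_congr rfl fun i _ => ?_
  rw [inner_sum, Finset.sum_eq_single i]
  · rw [inner_ket, if_pos ⟨rfl, rfl⟩]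
  · intro j _ hj
    rw [inner_ket, if_neg fun h => hj h.1.symm]
  · simp

lemma inner_extra_place (a : Fin q) (x : Fin n → Fin q) (h : H) :
    ⟪extra 𝕜 n q H a, P.place x h⟫_ℂ = 0 := by
  simp [place, inner_extra_ket]

lemma norm_extra_add_place_sq (a : Fin q) (x : Fin n → Fin q) (h : H) :
    ‖extra 𝕜 n q H a + P.place x h‖ ^ 2 = 1 + ‖h‖ ^ 2 := by
  have h1 := norm_add_sq_eq_norm_sq_add_norm_sq_of_inner_eq_zero _ _ (P.inner_extra_place a x h)
  have h2 : ‖P.place x h‖ ^ 2 = ‖h‖ ^ 2 := by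
    have := P.inner_place x h h
    rw [inner_self_eq_norm_sq_to_K, inner_self_eq_norm_sq_to_K, ← RCLike.ofReal_pow,
      ← RCLike.ofReal_pow, RCLike.map_ofReal_complex] at this
    exact Complex.ofReal_injective this
  rw [norm_extra] at h1
  nlinarith

lemma inner_extra_add_place (x : Fin n → Fin q) (h : H) :
    ⟪extra 𝕜 n q H 0 + P.place x h, extra 𝕜 n q H 0⟫_ℂ = 1 := by
  rw [inner_add_left, ← inner_conj_symm (P.place x h), inner_extra_place,
    inner_self_eq_norm_sq_to_K, norm_extra]
  simp

/-- The span of the `|i⟩|a⟩|h⟩` with `h ∈ H_{i,a}`. -/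
noncomputable def partSpan : Submodule ℂ (QueryState n q (finrank 𝕜 H + 1)) :=
  Submodule.span ℂ {ψ | ∃ i a, ∃ h ∈ P.fullPart i a, ψ = ket 𝕜 i a h}

variable (𝕜 n q H) in
/-- The span of the extra basis states. -/
noncomputable def extraSpan : Submodule ℂ (QueryState n q (finrank 𝕜 H + 1)) :=
  Submodule.span ℂ (Set.range (extra 𝕜 n q H))

/-- The kernel of `c ⊕ h ↦ c τ - α A h`, embedded into the state space. -/
noncomputable def kernelSpan (α : ℝ) : Submodule ℂ (QueryState n q (finrank 𝕜 H + 1)) :=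
  Submodule.span ℂ {ψ | ∃ (c : 𝕜) (h : H), c • P.target = (α : 𝕜) • P.A h ∧
    ψ = RCLike.map 𝕜 ℂ c • extra 𝕜 n q H 0 + P.place 0 h}

lemma place_mem_partSpan {x : Fin n → Fin q} {h : H} (hh : h ∈ P.space x) :
    P.place x h ∈ P.partSpan :=
  Submodule.sum_mem _ fun i _ =>
    Submodule.subset_span ⟨i, x i, _, P.starProjection_fullBlock_mem hh i, rfl⟩

/-- Only the generators |i⟩|a⟩|g⟩ with a = x_i can overlap with the vector, and for these g lies in
H(x). -/
lemma place_mem_partSpan_orthogonal {x : Fin n → Fin q} {h : H} (hh : h ∈ (P.space x)ᗮ) :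
    P.place x h ∈ P.partSpanᗮ := by
  refine Submodule.mem_span_orthogonal ?_
  rintro _ ⟨i, a, g, hg, rfl⟩
  rw [place, sum_inner]
  refine Finset.sum_eq_zero fun j _ => ?_
  rw [inner_ket]
  split_ifs with hj
  · obtain ⟨rfl, rfl⟩ := hj
    rw [Submodule.inner_starProjection_left_eq_right,
      Submodule.starProjection_eq_self_iff.2 (P.fullPart_le_fullBlock _ _ hg),
      (Submodule.mem_orthogonal' _ _).1 hh _ (P.fullPart_le_space x _ hg), map_zero]
  · rfl

lemma extra_mem_partSpan_orthogonal (a : Fin q) : extra 𝕜 n q H a ∈ P.partSpanᗮ := by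
  refine Submodule.mem_span_orthogonal ?_
  rintro _ ⟨i, b, g, hg, rfl⟩
  exact inner_extra_ket _ _ _ _

lemma place_mem_extraSpan_orthogonal (x : Fin n → Fin q) (h : H) :
    P.place x h ∈ (extraSpan 𝕜 n q H)ᗮ := by
  refine Submodule.mem_span_orthogonal ?_
  rintro _ ⟨a, rfl⟩
  rw [← inner_conj_symm, inner_extra_place, map_zero]

lemma mem_kernelSpan {α : ℝ} (hα : 0 < α) {w : H} (hw : P.A w = P.target) :
    extra 𝕜 n q H 0 + P.place 0 ((α : 𝕜)⁻¹ • w) ∈ P.kernelSpan α := by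
  refine Submodule.subset_span ⟨1, (α : 𝕜)⁻¹ • w, ?_, ?_⟩
  · have : (α : 𝕜) ≠ 0 := by exact_mod_cast hα.ne'
    rw [map_smul, smul_smul, mul_inv_cancel₀ this, hw]
  · have := RCLike.map_ofReal_complex (𝕜 := 𝕜) 1
    simp only [RCLike.ofReal_one, Complex.ofReal_one] at this
    rw [this, one_smul]

/-- Pairing with the generator given by c and h yields c − αω(Ah), which is ω applied to cτ − αAh =
0. -/
lemma mem_kernelSpan_orthogonal (α : ℝ) {ω : V →ₗ[𝕜] 𝕜} (hω : ω P.target = 1) {g : H}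
    (hg : ∀ h, ⟪g, h⟫_𝕜 = ω (P.A h)) :
    extra 𝕜 n q H 0 + P.place 0 (-(α : 𝕜) • g) ∈ (P.kernelSpan α)ᗮ := by
  refine Submodule.mem_span_orthogonal ?_
  rintro _ ⟨c, h, hch, rfl⟩
  have h1 : ⟪P.place 0 (-(α : 𝕜) • g), extra 𝕜 n q H 0⟫_ℂ = 0 := by
    rw [← inner_conj_symm, inner_extra_place, map_zero]
  have h2 := congrArg ω hch
  rw [map_smul, map_smul, hω, smul_eq_mul, smul_eq_mul, mul_one] at h2
  rw [inner_add_left, inner_add_right, inner_add_right, inner_smul_right, inner_smul_right, h1,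
    inner_extra_place, inner_place, inner_self_eq_norm_sq_to_K, norm_extra, inner_smul_left, hg,
    map_neg, RCLike.conj_ofReal, neg_mul, ← h2, map_neg]
  simp

/-- `P` has a witness for `x`, positive or negative according to `v`, of size at most `s`. -/
def HasWitness (P : SpanProgram 𝕜 n q H V) (x : Fin n → Fin q) (v : Bool) (s : ℝ) : Prop :=
  match v with
  | true => ∃ w, P.IsPositiveWitness x w ∧ ‖w‖ ^ 2 ≤ s
  | false => ∃ ω, P.IsNegativeWitness x ω ∧
      ‖LinearMap.toContinuousLinearMap (ω ∘ₗ P.A)‖ ^ 2 ≤ s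

lemma HasWitness.exists_positive {x : Fin n → Fin q} {s : ℝ} (h : P.HasWitness x true s)
    {α : ℝ} (hα : 0 < α) :
    ∃ u ∈ P.kernelSpan α, ‖u‖ ^ 2 ≤ 1 + s / α ^ 2 ∧ ⟪u, extra 𝕜 n q H 0⟫_ℂ = 1 ∧
      oracle _ x (u - extra 𝕜 n q H 0) ∈ P.partSpan ⊓ (extraSpan 𝕜 n q H)ᗮ := by
  obtain ⟨w, hw, hs⟩ : ∃ w, P.IsPositiveWitness x w ∧ ‖w‖ ^ 2 ≤ s := h
  refine ⟨_, P.mem_kernelSpan hα hw.2, ?_, P.inner_extra_add_place _ _, ?_⟩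
  · rw [norm_extra_add_place_sq, norm_smul, norm_inv, RCLike.norm_ofReal, abs_of_pos hα, mul_pow,
      inv_pow, ← div_eq_inv_mul]
    gcongr
  · rw [add_sub_cancel_left, oracle_place]
    exact ⟨P.place_mem_partSpan (Submodule.smul_mem _ _ hw.1),
      P.place_mem_extraSpan_orthogonal _ _⟩

lemma HasWitness.exists_negative {x : Fin n → Fin q} {s : ℝ} (h : P.HasWitness x false s)
    (α : ℝ) :
    ∃ v ∈ (P.kernelSpan α)ᗮ, ‖v‖ ^ 2 ≤ 1 + α ^ 2 * s ∧ ⟪v, extra 𝕜 n q H 0⟫_ℂ = 1 ∧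
      oracle _ x (v - extra 𝕜 n q H 0) ∈ P.partSpanᗮ ⊓ (extraSpan 𝕜 n q H)ᗮ := by
  have : CompleteSpace H := FiniteDimensional.complete 𝕜 H
  obtain ⟨ω, hω, hs⟩ : ∃ ω, P.IsNegativeWitness x ω ∧
    ‖LinearMap.toContinuousLinearMap (ω ∘ₗ P.A)‖ ^ 2 ≤ s := h
  set g := (InnerProductSpace.toDual 𝕜 H).symm (LinearMap.toContinuousLinearMap (ω ∘ₗ P.A))
  have hg : ∀ h, ⟪g, h⟫_𝕜 = ω (P.A h) := fun h => InnerProductSpace.toDual_symm_apply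
  have hgs : ‖g‖ ^ 2 ≤ s := by rwa [LinearIsometryEquiv.norm_map]
  refine ⟨_, P.mem_kernelSpan_orthogonal α hω.1 hg, ?_, P.inner_extra_add_place _ _, ?_⟩
  · rw [norm_extra_add_place_sq, norm_smul, norm_neg, RCLike.norm_ofReal, mul_pow, sq_abs]
    gcongr
  · rw [add_sub_cancel_left, oracle_place]
    refine ⟨P.place_mem_partSpan_orthogonal (Submodule.smul_mem _ _ ?_),
      P.place_mem_extraSpan_orthogonal _ _⟩
    rw [Submodule.mem_orthogonal']
    intro h hh
    rw [hg, ← Submodule.starProjection_eq_self_iff.2 hh]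
    exact hω.2 h

/-- A test for a witness of kind `v` and size at most `σ`, which is reliable when there is a witness
of the other kind whose size is not too large. -/
theorem exists_isTrial (v : Bool) {σ : ℝ} (hσ : 0 < σ) {M N : ℕ} (hN : 0 < N) (hNM : N ≤ M)
    (s₀ : QueryBasis n q ((finrank 𝕜 H + 1) * M)) :
    ∃ T : (Bool → QueryProtocol n q _) → QueryProtocol n q _,
      ∀ x : Fin n → Fin q, ∃ p, QueryProtocol.IsTrial s₀ x T (2 * N) p ∧
        (P.HasWitness x v σ → 63 / 64 ≤ p) ∧
        ∀ s, P.HasWitness x (!v) s → 64 * (1 + 64 * σ * s) ≤ (N : ℝ) ^ 2 → p ≤ 1 / 64 := by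
  have hsplit : ∀ (x : Fin n → Fin q) (u : QueryState n q (finrank 𝕜 H + 1)),
      oracle _ x u = oracle _ x (extra 𝕜 n q H 0) + oracle _ x (u - extra 𝕜 n q H 0) := by
    intro x u
    rw [← map_add, add_sub_cancel]
  cases v
  -- Both subspaces are replaced by their complements, so α is inverted. The complement of
  -- `partSpan` already contains the extra states.
  · set α := √(64 * σ)⁻¹
    have hα : 0 < α := by positivity
    have hα2 : α ^ 2 = (64 * σ)⁻¹ := Real.sq_sqrt (by positivity)
    obtain ⟨T, hT⟩ := exists_isTrial_walk hN hNM s₀ P.partSpanᗮ (P.kernelSpan α)ᗮ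
      (norm_extra (𝕜 := 𝕜) (H := H) 0)
    refine ⟨T, fun x => ?_⟩
    obtain ⟨p, hp, hacc, hrej⟩ := hT x
    refine ⟨p, hp, fun h => ?_, fun s h hs => ?_⟩
    · obtain ⟨u, hu, hnorm, hin, hor⟩ := HasWitness.exists_negative P h α
      refine hacc u hu ?_ hin (hnorm.trans ?_)
      · rw [hsplit, oracle_extra]
        exact Submodule.add_mem _ (P.extra_mem_partSpan_orthogonal _) hor.1
      · rw [hα2]
        field_simp
        norm_num
    · obtain ⟨u, hu, hnorm, hin, hor⟩ := HasWitness.exists_positive P h hα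
      refine hrej u (Submodule.le_orthogonal_orthogonal _ hu) ?_
        (Submodule.le_orthogonal_orthogonal _ hor.1) (le_trans ?_ hs)
      · rw [oracle_extra]
        exact P.extra_mem_partSpan_orthogonal _
      · rw [hα2, div_inv_eq_mul] at hnorm
        linarith
  -- This makes 1 + σ/α² = 65/64 for acceptance and 1 + α²s = 1 + 64σs for rejection.
  · set α := √(64 * σ)
    have hα : 0 < α := by positivity
    have hα2 : α ^ 2 = 64 * σ := Real.sq_sqrt (by positivity)
    obtain ⟨T, hT⟩ := exists_isTrial_walk hN hNM s₀ (P.partSpan ⊔ extraSpan 𝕜 n q H)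
      (P.kernelSpan α) (norm_extra (𝕜 := 𝕜) (H := H) 0)
    -- All answers `a` are needed, since the oracle moves the start vector to the extra state with
    -- answer x_0.
    have hex : ∀ a, extra 𝕜 n q H a ∈ P.partSpan ⊔ extraSpan 𝕜 n q H := fun a =>
      (le_sup_right : _ ≤ P.partSpan ⊔ _) (Submodule.subset_span ⟨a, rfl⟩)
    refine ⟨T, fun x => ?_⟩
    obtain ⟨p, hp, hacc, hrej⟩ := hT x
    refine ⟨p, hp, fun h => ?_, fun s h hs => ?_⟩
    · obtain ⟨u, hu, hnorm, hin, hor⟩ := HasWitness.exists_positive P h hα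
      refine hacc u hu ?_ hin (hnorm.trans ?_)
      · rw [hsplit, oracle_extra]
        exact Submodule.add_mem _ (hex _) ((le_sup_left : P.partSpan ≤ _) hor.1)
      · rw [hα2]
        field_simp
        norm_num
    · obtain ⟨u, hu, hnorm, hin, hor⟩ := HasWitness.exists_negative P h α
      refine hrej u hu ?_ (Submodule.inf_orthogonal P.partSpan _ ▸ hor) (le_trans ?_ hs)
      · rw [oracle_extra]
        exact hex _
      · rw [hα2] at hnorm
        linarith

end Embedding

end SpanProgram

/-! ### Witness sizes, step counts and the assembled algorithm. -/

namespace SpanProgram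

variable {𝕜 : Type*} [RCLike 𝕜] {n q : ℕ}
  {H : Type*} [NormedAddCommGroup H] [InnerProductSpace 𝕜 H] [FiniteDimensional 𝕜 H]
  {V : Type*} [AddCommGroup V] [Module 𝕜 V] {P : SpanProgram 𝕜 n q H V}

lemma not_isPositiveWitness {x : Fin n → Fin q} {ω : V →ₗ[𝕜] 𝕜} (hω : P.IsNegativeWitness x ω)
    (w : H) : ¬ P.IsPositiveWitness x w := by
  rintro ⟨hw, hA⟩
  have h := hω.2 w
  rw [Submodule.starProjection_eq_self_iff.2 hw, hA, hω.1] at h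
  exact one_ne_zero h

/-- The strict bound makes it unnecessary to know that the infimum is attained. -/
lemma Decides.hasWitness {X : Set (Fin n → Fin q)} {f : X → Bool} (hf : P.Decides f) (x : X)
    {s : ℝ} (hs : P.witnessSize x < s) : P.HasWitness x (f x) s := by
  cases hv : f x
  · obtain ⟨ω, hω⟩ := hf.2 x hv
    have hno : ¬ ∃ w, P.IsPositiveWitness x w := fun ⟨w, hw⟩ => not_isPositiveWitness hω w hw
    rw [witnessSize, if_neg hno, negativeSize] at hs
    obtain ⟨_, ⟨ω', hω', rfl⟩, h⟩ := exists_lt_of_csInf_lt (by exact ⟨_, ω, hω, rfl⟩) hs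
    exact ⟨ω', hω', h.le⟩
  · obtain ⟨w, hw⟩ := hf.1 x hv
    rw [witnessSize, if_pos ⟨w, hw⟩, positiveSize] at hs
    obtain ⟨_, ⟨w', hw', rfl⟩, h⟩ := exists_lt_of_csInf_lt (by exact ⟨_, w, hw, rfl⟩) hs
    exact ⟨w', hw', h.le⟩

lemma witnessSize_le_maxWitnessSize {X : Set (Fin n → Fin q)} (x : X) :
    P.witnessSize x ≤ P.maxWitnessSize X :=
  le_ciSup (f := fun χ : X => P.witnessSize χ) (Set.finite_range _).bddAbove x

/-- The number of steps of the test for witnesses of size `2 * 2 ^ i`, if all sizes are at most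
`2 * W`. -/
noncomputable def numSteps (W : ℝ) (i : ℕ) : ℕ := ⌈8 * √(1 + 256 * 2 ^ i * W)⌉₊

lemma numSteps_mono {W : ℝ} (hW : 0 ≤ W) : Monotone (numSteps W) := by
  intro i j hij
  unfold numSteps
  gcongr
  norm_num

lemma numSteps_pos {W : ℝ} (hW : 0 ≤ W) (i : ℕ) : 0 < numSteps W i :=
  Nat.ceil_pos.2 (by positivity)

/-- The rejection condition of `exists_isTrial` for σ = 2·2^i and s = 2W, with 256 = 64·2·2. -/
lemma le_numSteps_sq {W : ℝ} (hW : 0 ≤ W) (i : ℕ) :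
    64 * (1 + 256 * 2 ^ i * W) ≤ (numSteps W i : ℝ) ^ 2 := by
  have h1 : 8 * √(1 + 256 * 2 ^ i * W) ≤ numSteps W i := Nat.le_ceil _
  have h2 := pow_le_pow_left₀ (by positivity) h1 2
  rw [mul_pow, Real.sq_sqrt (by positivity)] at h2
  linarith

lemma numSteps_le {w W : ℝ} (hw : 1 ≤ w) (hW : 1 ≤ W) {i : ℕ} (hi : (2 : ℝ) ^ i ≤ 2 * w) :
    (numSteps W i : ℝ) ≤ 185 * √(w * W) := by
  have hwW : 1 ≤ w * W := one_le_mul_of_one_le_of_one_le hw hW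
  have h1 : 1 ≤ √(w * W) := Real.one_le_sqrt.2 hwW
  have h2 : √(1 + 256 * 2 ^ i * W) ≤ 23 * √(w * W) := by
    -- The radicand is at most 513wW ≤ 23²wW; the rounding then gives 8·23 + 1 = 185.
    refine Real.sqrt_le_iff.2 ⟨by positivity, ?_⟩
    rw [mul_pow, Real.sq_sqrt (by positivity)]
    have := mul_le_mul_of_nonneg_right hi (by linarith : 0 ≤ W)
    nlinarith
  have h3 := Nat.ceil_lt_add_one (a := 8 * √(1 + 256 * 2 ^ i * W)) (by positivity)
  unfold numSteps
  linarith

lemma le_two_pow_ceil_logb {w : ℝ} (hw : 1 ≤ w) : w ≤ 2 ^ ⌈Real.logb 2 w⌉₊ := by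
  rw [← Real.rpow_natCast, ← Real.logb_le_iff_le_rpow one_lt_two (by linarith)]
  exact Nat.le_ceil _

lemma two_pow_ceil_logb_le {w : ℝ} (hw : 1 ≤ w) : (2 : ℝ) ^ ⌈Real.logb 2 w⌉₊ ≤ 2 * w := by
  have h := Nat.ceil_lt_add_one (Real.logb_nonneg one_lt_two hw)
  calc (2 : ℝ) ^ ⌈Real.logb 2 w⌉₊ = 2 ^ (⌈Real.logb 2 w⌉₊ : ℝ) := (Real.rpow_natCast _ _).symm
    _ ≤ 2 ^ (Real.logb 2 w + 1) := Real.rpow_le_rpow_of_exponent_le one_le_two h.le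
    _ = 2 * w := by
      rw [Real.rpow_add two_pos, Real.rpow_logb two_pos (by norm_num) (by linarith)]
      norm_num [mul_comm]

open QueryProtocol in
/-- An algorithm whose success probability and number of queries are given in terms of the number
`m` of repetitions of the tests. -/
theorem exists_algorithm [NeZero n] [NeZero q] (P : SpanProgram 𝕜 n q H V)
    {X : Set (Fin n → Fin q)} {f : X → Bool} (hf : P.Decides f)
    (h1 : ∀ x : X, 1 ≤ P.witnessSize x) {W : ℝ} (hW : ∀ x : X, P.witnessSize x ≤ W) (hW1 : 1 ≤ W)
    (m : ℕ) :
    ∃ 𝒜 : QueryAlgorithm n q, ∀ (x : X) (Q : ℝ),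
      4 * m * (Real.logb 2 (P.witnessSize x) + 2) * (185 * √(P.witnessSize x * W)) ≤ Q →
      1 - 2 * (Real.logb 2 (P.witnessSize x) + 2) * (1 / 4 : ℝ) ^ m ≤
        𝒜.prob x fun b t => b = f x ∧ (t : ℝ) ≤ Q := by
  have hW0 : 0 ≤ W := by linarith
  set L := ⌈Real.logb 2 W⌉₊
  set M := numSteps W L
  have hd : 0 < (Module.finrank 𝕜 H + 1) * M := Nat.mul_pos (Nat.succ_pos _) (numSteps_pos hW0 _)
  set s₀ : QueryBasis n q ((Module.finrank 𝕜 H + 1) * M) := (0, 0, ⟨0, hd⟩)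
  -- Capping the level at `L` lets the tests of all levels share one clock of `M` layers.
  have hT : ∀ (i : ℕ) (v : Bool), _ := fun i v =>
    P.exists_isTrial v (σ := 2 * 2 ^ min i L) (by positivity) (numSteps_pos hW0 (min i L))
      (numSteps_mono hW0 (min_le_right i L)) s₀
  choose T hT using hT
  refine ⟨⟨_, s₀, scan T m (L + 1) 0⟩, fun x Q hQ => ?_⟩
  choose p hp hacc hrej using fun i v => hT i v x
  set w := P.witnessSize x with hw
  set r := ⌈Real.logb 2 w⌉₊
  have hlog : 0 ≤ Real.logb 2 w := Real.logb_nonneg one_lt_two (h1 x)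
  have hr1 : (r : ℝ) + 1 ≤ Real.logb 2 w + 2 := by
    linarith [Nat.ceil_lt_add_one hlog]
  have hrL : r ≤ L := Nat.ceil_mono
    (Real.logb_le_logb_of_le one_lt_two (by linarith [h1 x]) (hW x))
  have hrej' : ∀ j, j ≤ 0 + r → p j (!(f x)) ≤ 1 / 64 := by
    intro j hj
    refine hrej j _ (2 * W) ?_ ?_
    · rw [Bool.not_not]
      exact hf.hasWitness x (by linarith [hW x])
    · refine le_trans (le_of_eq ?_) (le_numSteps_sq hW0 (min j L))
      ring
  have hacc' : 63 / 64 ≤ p (0 + r) (f x) := by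
    rw [zero_add]
    refine hacc r _ (hf.hasWitness x ?_)
    rw [min_eq_left hrL]
    linarith [le_two_pow_ceil_logb (h1 x), h1 x]
  have h := le_weight_scan (m := m) (Q := Q) hp r (L + 1) 0 0 hrej' hacc'
    (Nat.lt_succ_of_le hrL) ?_
  · refine le_trans ?_ h
    have : (0 : ℝ) < (1 / 4) ^ m := by positivity
    nlinarith
  · refine le_trans ?_ hQ
    have hN : (numSteps W r : ℝ) ≤ 185 * √(w * W) :=
      numSteps_le (h1 x) hW1 (two_pow_ceil_logb_le (h1 x))
    -- Bounding every level by the last one loses only a logarithmic factor compared with the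
    -- geometric sum.
    have hsum : ∑ j ∈ Finset.range (r + 1), 2 * m * (2 * numSteps W (min (0 + j) L)) ≤
        (r + 1) * (2 * m * (2 * numSteps W r)) := by
      refine (Finset.sum_le_card_nsmul _ _ (2 * m * (2 * numSteps W r)) fun j hj => ?_).trans
        (le_of_eq (by simp))
      gcongr
      refine numSteps_mono hW0 ((min_le_left _ _).trans ?_)
      rw [Finset.mem_range] at hj
      omega
    have hsum' : ((0 + ∑ j ∈ Finset.range (r + 1),
        2 * m * (2 * numSteps W (min (0 + j) L)) : ℕ) : ℝ) ≤
          ((r + 1) * (2 * m * (2 * numSteps W r)) : ℕ) := by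
      rw [zero_add]
      exact_mod_cast hsum
    refine hsum'.trans ?_
    push_cast
    calc ((r : ℝ) + 1) * (2 * m * (2 * numSteps W r))
        ≤ (Real.logb 2 w + 2) * (2 * m * (2 * (185 * √(w * W)))) := by gcongr
      _ = _ := by ring

end SpanProgram

lemma QueryAlgorithm.prob_nonneg {n q : ℕ} [NeZero q] (𝒜 : QueryAlgorithm n q)
    (x : Fin n → Fin q) (E : Bool → ℕ → Prop) : 0 ≤ 𝒜.prob x E :=
  QueryProtocol.weight_nonneg _ _ _

theorem theorem3p1 :
    ∃ (C : ℝ) (k : ℕ), 0 < C ∧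
      ∀ (𝕜 : Type*) [RCLike 𝕜]
        (H : Type*) [NormedAddCommGroup H] [InnerProductSpace 𝕜 H] [FiniteDimensional 𝕜 H]
        (V : Type*) [AddCommGroup V] [Module 𝕜 V]
        (n q : ℕ) [NeZero n] [NeZero q]
        (P : SpanProgram 𝕜 n q H V) (X : Set (Fin n → Fin q)) (f : X → Bool),
        P.Decides f →
        (∀ x : X, 1 ≤ P.witnessSize x) →
        ∀ δ : ℝ, 0 < δ → δ < 1 →
          ∃ 𝒜 : QueryAlgorithm n q, ∀ x : X,
            1 - C * δ ≤ 𝒜.prob x (fun b t => b = f x ∧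
              (t : ℝ) ≤ C * (Real.sqrt (P.witnessSize x * P.maxWitnessSize X) *
                Real.logb 2 (1 / δ)) * (Real.logb 2 (2 + P.maxWitnessSize X)) ^ k) := by
  -- 8880 = 4·4·3·185; one power of the logarithm comes from the number of levels, the other from
  -- the repetitions.
  refine ⟨8880, 2, by norm_num, ?_⟩
  intro 𝕜 _ H _ _ _ V _ _ n q _ _ P X f hf h1 δ hδ hδ1
  set W := P.maxWitnessSize X
  have hW : ∀ x : X, P.witnessSize x ≤ W := fun x => SpanProgram.witnessSize_le_maxWitnessSize x
  -- For δ > 1/2 the claimed bound is negative; δ ≤ 1/2 ensures log₂(1/δ) ≥ 1.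
  by_cases htriv : IsEmpty X ∨ 1 / 2 < δ
  · refine ⟨⟨1, (0, 0, 0), .output true⟩, fun x => ?_⟩
    rcases htriv with h | h
    · exact h.elim x
    · exact le_trans (by linarith) (QueryAlgorithm.prob_nonneg _ _ _)
  · rw [not_or, not_isEmpty_iff, not_lt] at htriv
    obtain ⟨⟨x₀⟩, hδ2⟩ := htriv
    have hW1 : 1 ≤ W := (h1 x₀).trans (hW x₀)
    set a := Real.logb 2 (1 / δ) with ha_def
    set l := Real.logb 2 (2 + W) with hl_def
    have ha : 1 ≤ a := by
      rw [ha_def, Real.le_logb_iff_rpow_le one_lt_two (by positivity), Real.rpow_one,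
        le_div_iff₀ hδ]
      linarith
    have hl : 1 ≤ l := by
      rw [hl_def, Real.le_logb_iff_rpow_le one_lt_two (by positivity), Real.rpow_one]
      linarith
    -- This many repetitions give 4^{-m} ≤ δ/(2 + W), and the denominator absorbs the number of
    -- levels.
    obtain ⟨𝒜, h𝒜⟩ := P.exists_algorithm hf h1 hW hW1 (⌈a⌉₊ + ⌈l⌉₊)
    set m := ⌈a⌉₊ + ⌈l⌉₊ with hm_def
    refine ⟨𝒜, fun x => ?_⟩
    have hlog : Real.logb 2 (P.witnessSize x) + 2 ≤ 3 * l := by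
      have : Real.logb 2 (P.witnessSize x) ≤ l :=
        Real.logb_le_logb_of_le one_lt_two (by linarith [h1 x]) (by linarith [hW x])
      linarith
    have hlog0 : 0 ≤ Real.logb 2 (P.witnessSize x) := Real.logb_nonneg one_lt_two (h1 x)
    have hm : (m : ℝ) ≤ 4 * (a * l) := by
      have hA := Nat.ceil_lt_add_one (by linarith : 0 ≤ a)
      have hB := Nat.ceil_lt_add_one (by linarith : 0 ≤ l)
      rw [hm_def]
      push_cast
      nlinarith
    refine le_trans ?_ (h𝒜 x _ ?_)
    · have hpow : (1 / 4 : ℝ) ^ m ≤ δ / (2 + W) := by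
        have h2 : (1 / δ) * (2 + W) ≤ 2 ^ m := by
          rw [hm_def, pow_add]
          gcongr
          · rw [← Real.rpow_natCast, ← Real.logb_le_iff_le_rpow one_lt_two (by positivity)]
            exact Nat.le_ceil _
          · rw [← Real.rpow_natCast, ← Real.logb_le_iff_le_rpow one_lt_two (by positivity)]
            exact Nat.le_ceil _
        have h3 : (1 / 4 : ℝ) ^ m ≤ (1 / 2) ^ m := by gcongr; norm_num
        refine h3.trans ?_
        rw [one_div_pow]
        refine (one_div_le_one_div_of_le (by positivity) h2).trans (le_of_eq ?_)
        field_simp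
      have hlW : l ≤ 2 + W := by
        rw [hl_def, Real.logb_le_iff_le_rpow one_lt_two (by positivity)]
        -- Bernoulli's inequality in the form 1 + (2 + W) ≤ 2^(2 + W).
        have := one_add_mul_self_le_rpow_one_add (s := 1) (by norm_num)
          (p := 2 + W) (by linarith)
        norm_num at this ⊢
        linarith
      have h4 : 2 * (Real.logb 2 (P.witnessSize x) + 2) * (1 / 4 : ℝ) ^ m ≤
          2 * (3 * (2 + W)) * (δ / (2 + W)) := by
        gcongr
        linarith
      have h5 : 2 * (3 * (2 + W)) * (δ / (2 + W)) = 6 * δ := by field_simp; norm_num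
      linarith
    · calc 4 * (m : ℝ) * (Real.logb 2 (P.witnessSize x) + 2) * (185 * √(P.witnessSize x * W))
          ≤ 4 * (4 * (a * l)) * (3 * l) * (185 * √(P.witnessSize x * W)) := by gcongr
        _ = _ := by ring
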